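/- **Setting.** Let $n,m\ge 1$, $\mathcal X=\prod_{i=1}^n\mathbb R^{d_i}$, $\mathcal Y=\prod_{j=1}^m\mathbb R^{d'_j}$, $\mathcal Z=\mathcal X\times\mathcal Y$ with Euclidean norms, and let $A:\mathcal X\to\mathcal Y$ be linear with blocks $A_{j,i}$, every block row of $A$ being nonzero. Consider $\min_x f(x)+g(x)+h(Ax)$, where $f:\mathcal X\to\mathbb R$ is convex and differentiable, $g(x)=\sum_i g_i(x_i)$, the functions $g_i$ and $h$ are proper, lower semicontinuous and convex with values in $\mathbb R\cup\{+\infty\}$, $f(x+U_iu)\le f(x)+\langle\nabla_if(x),u\rangle+\frac{\beta_i}{2}\|u\|^2$ for all $x$, $i$, $u$ ($U_iu$ has block $i$ equal to $u$ and all other blocks $0$), $\nabla f$ is $\bar\beta$-Lipschitz, and $0\in\mathrm{ri}(\mathrm{dom}\,h-A\,\mathrm{dom}\,g)$. Let $F(x,y)=\big(\nabla f(x)+\partial g(x)+A^\top y,\ Ax-\partial h^*(y)\big)$ be the KKT operator and assume that $\mathcal Z_\star=\{z:0\in F(z)\}$ is nonempty. **Algorithm.** Let $p_i>0$ with $\sum_ip_i=1$,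 $\underline p=\min_ip_i$, $\pi_j=\sum_{i:A_{j,i}\ne0}p_i$, $\theta_j=\pi_j/\underline p$, and let $\sigma_j>0$, $\tau_i>0$ satisfy $$\tau_i<\frac{2p_i-\underline p}{\beta_ip_i+\underline p^{-1}p_i\sum_j\pi_j\sigma_j\|A_{j,i}\|^2}$$ (no upper bound if the denominator is $0$). We write $P,\pi,\theta,\tau,\sigma$ also for the corresponding block-diagonal matrices, $\|x\|_W^2=\langle x,Wx\rangle$ and $\mathrm{prox}_{W,\varphi}(x)=\arg\min_u\varphi(u)+\frac12\|u-x\|^2_{W^{-1}}$. From a deterministic $z_0=(x_0,y_0)$ with $g(x_0)<\infty$, iterate for $k\ge 0$: $\bar y_{k+1}=\mathrm{prox}_{\sigma,h^*}(y_k+\sigma Ax_k)$, $\bar x_{k+1}=\mathrm{prox}_{\tau,g}(x_k-\tau(\nabla f(x_k)+A^\top\bar y_{k+1}))$; draw $i_{k+1}$ independently of the past with $\mathbb P(i_{k+1}=i)=p_i$; set $x_{k+1}^{i}=\bar x_{k+1}^{i}$ for $i=i_{k+1}$ and $x_{k+1}^i=x_k^i$ otherwise; set $y_{k+1}^j=\bar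 y_{k+1}^j+\sigma_j\theta_j(A(x_{k+1}-x_k))_j$ if $A_{j,i_{k+1}}\neq0$ and $y_{k+1}^j=y_k^j$ otherwise. Put $z_k=(x_k,y_k)$ and $\bar z_k=(\bar x_k,\bar y_k)$. **Metric subregularity.** Assume that $F$ is metrically subregular at every $z_\star\in\mathcal Z_\star$ for $0$: there are $\eta_{z_\star}>0$ and a neighbourhood $\mathcal N(z_\star)$ of $z_\star$ with $\mathrm{dist}(z,\mathcal Z_\star)\le\eta_{z_\star}\,\mathrm{dist}(0,F(z))$ for all $z\in\mathcal N(z_\star)$, where $\mathrm{dist}$ is the (unsquared) Euclidean distance. Assume also that, almost surely, $\bar z_k\in\mathcal N(z_\star)$ for all $k\ge1$ and all $z_\star\in\mathcal Z_\star$. **Constants.** Let $$V(z)=\tfrac{\underline p}2\|x\|^2_{\tau^{-1}P^{-1}}+\tfrac{\underline p}2\|y\|^2_{\sigma^{-1}\pi^{-1}},$$ $$D_p(x;u)=f(x)+g(x)-f(u_x)-g(u_x)+\langle A^\top u_y,x-u_x\rangle\quad\text{for }u=(u_x,u_y),$$ $$z_k^\star=(x_k^\star,y_k^\star)=\arg\min_{u\in\mathcal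 Z_\star}D_p(x_k;u)+V(z_k-u),\qquad \Delta_0=D_p(x_0;z_0^\star)+V(z_0-z_0^\star),$$ $$C(\tau)_i=\tfrac{2p_i}{\underline p\tau_i}-\tfrac1{\tau_i}-p_i\sum_j\pi_j^{-1}\sigma_j\theta_j^2\|A_{j,i}\|^2-\tfrac{\beta_ip_i}{\underline p},$$ $$C_{2,\tilde V}=\tfrac{\underline p}2\min\{\min_iC(\tau)_i,\min_j\sigma_j^{-1}\},\qquad C_{V,2}=\tfrac12\max\{\max_i\tau_i^{-1},\max_j\sigma_j^{-1}\},$$ $$C_{2,V}=\sqrt{\tfrac{2}{\underline p\,\min\{\min_i\tau_i^{-1}p_i^{-1},\ \min_j\sigma_j^{-1}\pi_j^{-1}\}}},\qquad c=\tfrac12C_{2,V}^2\|A\|,$$ $$H=\begin{bmatrix}\tau^{-1}&A^\top\\0&\sigma^{-1}\end{bmatrix},\qquad M=\begin{bmatrix}0&A^\top\\-A&0\end{bmatrix}.$$ **Theorem 2.** The minimizer $z_k^\star$ exists and is unique for every $k$ (and every realization of the indices). For $\eta=\eta_{z_\star}$ with any $z_\star\in\mathcal Z_\star$, the number $$\rho=\min\Big(\underline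 p,\ \frac{C_{2,\tilde V}}{C_{V,2}\big((2+2c)+(1+c)\,\eta\,(\|H-M\|+\bar\beta)\big)^2}\Big)$$ satisfies $0<\rho<1$, and for every $k\ge0$ $$\mathbb E\Big[\tfrac{\underline p}2\|x_k-x_k^\star\|^2_{\tau^{-1}P^{-1}}+\tfrac{\underline p}2\|y_k-y_k^\star\|^2_{\sigma^{-1}\pi^{-1}}\Big]\le(1-\rho)^k\Delta_0.$$ -/

import Mathlib

open MeasureTheory ProbabilityTheory Topology
open scoped RealInnerProductSpace

noncomputable section

namespace PureCD

/-! ### Block Euclidean spaces -/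

/-- The Euclidean product of `n` blocks, the `i`-th block being `ℝ ^ (d i)`. -/
abbrev BlockSpace {n : ℕ} (d : Fin n → ℕ) : Type :=
  PiLp 2 (fun i => EuclideanSpace ℝ (Fin (d i)))

/-- The Euclidean primal-dual space of pairs `z = (x, y)`. -/
abbrev PDSpace {n m : ℕ} (dX : Fin n → ℕ) (dY : Fin m → ℕ) : Type :=
  WithLp 2 (BlockSpace dX × BlockSpace dY)

/-- The pair `(x, y)`. -/
def pair {n m : ℕ} {dX : Fin n → ℕ} {dY : Fin m → ℕ}
    (x : BlockSpace dX) (y : BlockSpace dY) : PDSpace dX dY := WithLp.toLp 2 (x, y)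

/-- `U_i(u)`: the vector whose block `i` is `u` and whose other blocks are `0`. -/
def embed {n : ℕ} {d : Fin n → ℕ} (i : Fin n) (u : EuclideanSpace ℝ (Fin (d i))) :
    BlockSpace d := WithLp.toLp 2 (Pi.single i u)

/-- The block-diagonal operator `diag(w_1, …, w_n)`. -/
def diagOp {n : ℕ} {d : Fin n → ℕ} (w : Fin n → ℝ) : BlockSpace d →L[ℝ] BlockSpace d :=
  LinearMap.toContinuousLinearMap
    { toFun := fun x => WithLp.toLp 2 (fun i => w i • x i)
      map_add' := by
        intro x y
        ext i : 1
        simp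
      map_smul' := by
        intro c x
        ext i : 1
        simp [smul_comm c] }

/-- The weighted squared norm `‖x‖²_w = ∑ i, w_i ‖x_i‖²`. -/
def wNormSq {n : ℕ} {d : Fin n → ℕ} (w : Fin n → ℝ) (x : BlockSpace d) : ℝ :=
  ∑ i, w i * ‖x i‖ ^ 2

/-- The block `A_{j,i}` of a linear operator `A`. -/
def block {n m : ℕ} {dX : Fin n → ℕ} {dY : Fin m → ℕ}
    (A : BlockSpace dX →L[ℝ] BlockSpace dY) (j : Fin m) (i : Fin n) :
    EuclideanSpace ℝ (Fin (dX i)) →L[ℝ] EuclideanSpace ℝ (Fin (dY j)) :=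
  LinearMap.toContinuousLinearMap
    { toFun := fun u => (A (embed i u)) j
      map_add' := by
        intro u v
        have : (embed i (u + v) : BlockSpace dX) = embed i u + embed i v := by
          simp [embed, Pi.single_add]
        simp [this]
      map_smul' := by
        intro c u
        have : (embed i (c • u) : BlockSpace dX) = c • embed i u := by
          simp [embed, Pi.single_smul]
        simp [this] }

/-- The operator `(x, y) ↦ (a x + b y, c x + e y)` on the primal-dual space. -/
def blockMatrix {n m : ℕ} {dX : Fin n → ℕ} {dY : Fin m → ℕ}
    (a : BlockSpace dX →L[ℝ] BlockSpace dX) (b : BlockSpace dY →L[ℝ] BlockSpace dX)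
    (c : BlockSpace dX →L[ℝ] BlockSpace dY) (e : BlockSpace dY →L[ℝ] BlockSpace dY) :
    PDSpace dX dY →L[ℝ] PDSpace dX dY :=
  LinearMap.toContinuousLinearMap
    { toFun := fun z => pair (a z.fst + b z.snd) (c z.fst + e z.snd)
      map_add' := by
        intro z z'
        simp only [pair, WithLp.add_fst, WithLp.add_snd, map_add, ← WithLp.toLp_add,
          Prod.mk_add_mk]
        congr 2 <;> abel
      map_smul' := by
        intro r z
        simp only [pair, WithLp.smul_fst, WithLp.smul_snd, map_smul, ← WithLp.toLp_smul,
          Prod.smul_mk, smul_add, RingHom.id_apply] }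

/-! ### Convex analysis for extended-real-valued functions -/

section ConvexAnalysis

variable {E : Type*} [NormedAddCommGroup E] [InnerProductSpace ℝ E]

/-- Proper, lower semicontinuous, convex functions `E → ℝ ∪ {+∞}`
(convexity through the epigraph). -/
structure ProperConvexLsc (φ : E → EReal) : Prop where
  ne_bot : ∀ x, φ x ≠ ⊥
  exists_ne_top : ∃ x, φ x ≠ ⊤
  lsc : LowerSemicontinuous φ
  convex : Convex ℝ {q : E × ℝ | φ q.1 ≤ (q.2 : EReal)}

/-- The Fenchel conjugate `φ^*`. -/
def conjugate (φ : E → EReal) (v : E) : EReal := ⨆ x, (((⟪v, x⟫ : ℝ) : EReal) - φ x)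

/-- The convex subdifferential (empty outside the domain). -/
def subdifferential (φ : E → EReal) (x : E) : Set E :=
  {v | φ x ≠ ⊤ ∧ ∀ u, φ x + ((⟪v, u - x⟫ : ℝ) : EReal) ≤ φ u}

/-- The set-valued mapping `F` is metrically subregular at `x` for `v`, with constant `η` and
neighbourhood of regularity `N`. The distance to the empty set is `+∞`. -/
structure MetricallySubregularAt {E' : Type*} [NormedAddCommGroup E']
    (F : E → Set E') (x : E) (v : E') (η : ℝ) (N : Set E) : Prop where
  mem_graph : v ∈ F x
  pos : 0 < η
  nhds : N ∈ 𝓝 x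
  bound : ∀ u ∈ N, Metric.infEDist u {u' | v ∈ F u'} ≤
    ENNReal.ofReal η * Metric.infEDist v (F u)

end ConvexAnalysis

/-- `q` is the proximal point `prox_{w, φ}(x)`, i.e. it minimizes
`u ↦ φ(u) + (1/2) ‖u - x‖²_{w⁻¹}`. -/
def IsProx {n : ℕ} {d : Fin n → ℕ} (w : Fin n → ℝ) (φ : BlockSpace d → EReal)
    (x q : BlockSpace d) : Prop :=
  ∀ u, φ q + ((1 / 2 * wNormSq w⁻¹ (q - x) : ℝ) : EReal) ≤
    φ u + ((1 / 2 * wNormSq w⁻¹ (u - x) : ℝ) : EReal)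

/-! ### The problem -/

/-- The data of `min_x f(x) + ∑ i, g_i(x_i) + h(A x)`. -/
structure Problem {n m : ℕ} (dX : Fin n → ℕ) (dY : Fin m → ℕ) where
  /-- the smooth part -/
  f : BlockSpace dX → ℝ
  /-- the blocks of the separable part -/
  g : ∀ i, EuclideanSpace ℝ (Fin (dX i)) → EReal
  /-- the composite part -/
  h : BlockSpace dY → EReal
  /-- the linear operator -/
  A : BlockSpace dX →L[ℝ] BlockSpace dY

/-- Parameters of the method: sampling probabilities, step sizes and coordinatewise Lipschitz
constants of `∇ f`. -/
structure Params (n m : ℕ) where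
  /-- sampling probabilities -/
  p : Fin n → ℝ
  /-- primal step sizes -/
  τ : Fin n → ℝ
  /-- dual step sizes -/
  σ : Fin m → ℝ
  /-- coordinatewise Lipschitz constants -/
  β : Fin n → ℝ

section

variable {n m : ℕ} {dX : Fin n → ℕ} {dY : Fin m → ℕ}

namespace Problem

variable (P : Problem dX dY)

/-- The separable function `g(x) = ∑ i, g_i(x_i)`. -/
def gSum (x : BlockSpace dX) : EReal := ∑ i, P.g i (x i)

/-- The transpose of `A`. -/
def AT : BlockSpace dY →L[ℝ] BlockSpace dX := ContinuousLinearMap.adjoint P.A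

/-- The KKT operator
`F(x, y) = (∇f(x) + ∂g(x) + Aᵀ y, A x - ∂h^*(y))`. -/
def kkt (z : PDSpace dX dY) : Set (PDSpace dX dY) :=
  {w | ∃ v ∈ subdifferential P.gSum z.fst, ∃ s ∈ subdifferential (conjugate P.h) z.snd,
    w = pair (gradient P.f z.fst + v + P.AT z.snd) (P.A z.fst - s)}

/-- The set of primal-dual solutions. -/
def solutions : Set (PDSpace dX dY) := {z | (0 : PDSpace dX dY) ∈ P.kkt z}

/-- `D_p(x; u) = f(x) + g(x) - f(u_x) - g(u_x) + ⟨Aᵀ u_y, x - u_x⟩`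
for `x` and `u_x` in the domain of `g`. -/
def Dp (x : BlockSpace dX) (u : PDSpace dX dY) : ℝ :=
  P.f x + (P.gSum x).toReal - P.f u.fst - (P.gSum u.fst).toReal + ⟪P.AT u.snd, x - u.fst⟫

/-- Standing assumptions on the problem, with coordinatewise Lipschitz constants `β`. -/
structure Standing (β : Fin n → ℝ) : Prop where
  f_convex : ConvexOn ℝ Set.univ P.f
  f_diff : Differentiable ℝ P.f
  g_convex : ∀ i, ProperConvexLsc (P.g i)
  h_convex : ProperConvexLsc P.h
  coord_lipschitz : ∀ (x : BlockSpace dX) (i : Fin n) (u : EuclideanSpace ℝ (Fin (dX i))),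
    P.f (x + embed i u) ≤ P.f x + ⟪gradient P.f x i, u⟫ + β i / 2 * ‖u‖ ^ 2
  solutions_nonempty : P.solutions.Nonempty
  slater : (0 : BlockSpace dY) ∈ intrinsicInterior ℝ
    {w | ∃ v x, P.h v ≠ ⊤ ∧ P.gSum x ≠ ⊤ ∧ w = v - P.A x}

end Problem

/-! ### Parameters and constants -/

variable (P : Problem dX dY) (a : Params n m)

/-- `min_i p_i`. -/
def pMin : ℝ := ⨅ i, a.p i

open Classical in
/-- `π_j = ∑_{i ∈ I(j)} p_i`, with `I(j) = {i : A_{j,i} ≠ 0}`. -/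
def piW (j : Fin m) : ℝ := ∑ i with block P.A j i ≠ 0, a.p i

/-- `θ_j = π_j / min_i p_i`. -/
def theta (j : Fin m) : ℝ := piW P a j / pMin a

/-- The function `V(z) = (p_min / 2) (‖x‖²_{τ⁻¹ P⁻¹} + ‖y‖²_{σ⁻¹ π⁻¹})`. -/
def V (z : PDSpace dX dY) : ℝ :=
  pMin a / 2 * wNormSq (fun i => (a.τ i)⁻¹ * (a.p i)⁻¹) z.fst +
    pMin a / 2 * wNormSq (fun j => (a.σ j)⁻¹ * (piW P a j)⁻¹) z.snd

/-- The constants `C(τ)_i`. -/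
def Ctau (i : Fin n) : ℝ :=
  2 * a.p i / (pMin a * a.τ i) - 1 / a.τ i
    - a.p i * ∑ j, (piW P a j)⁻¹ * a.σ j * theta P a j ^ 2 * ‖block P.A j i‖ ^ 2
    - a.β i * a.p i / pMin a

/-- Positive probabilities and step sizes; the primal step sizes satisfy
`τ_i < (2 p_i - p_min) / (β_i p_i + p_min⁻¹ p_i ∑ j, π_j σ_j ‖A_{j,i}‖²)`, where the right-hand
side is `+∞` if the denominator vanishes. -/
structure Params.Admissible : Prop where
  p_pos : ∀ i, 0 < a.p i
  p_sum : ∑ i, a.p i = 1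
  τ_pos : ∀ i, 0 < a.τ i
  σ_pos : ∀ j, 0 < a.σ j
  step : ∀ i, a.τ i * (a.β i * a.p i
    + (pMin a)⁻¹ * a.p i * ∑ j, piW P a j * a.σ j * ‖block P.A j i‖ ^ 2) < 2 * a.p i - pMin a

/-- `C_{2, Ṽ}`. -/
def C2Vt : ℝ := pMin a / 2 * min (⨅ i, Ctau P a i) (⨅ j, (a.σ j)⁻¹)

/-- `C_{V, 2}`. -/
def CV2 : ℝ := 1 / 2 * max (⨆ i, 1 / a.τ i) (⨆ j, 1 / a.σ j)

/-- `C_{2, V}`, the constant in `‖z‖ ≤ C_{2,V} V(z)^{1/2}`. -/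
def C2V : ℝ :=
  √(2 / (pMin a * min (⨅ i, (a.τ i)⁻¹ * (a.p i)⁻¹) (⨅ j, (a.σ j)⁻¹ * (piW P a j)⁻¹)))

/-- `c = C_{2,V}² ‖A‖ / 2`. -/
def cConst : ℝ := C2V P a ^ 2 * ‖P.A‖ / 2

/-- `H = [τ⁻¹, Aᵀ; 0, σ⁻¹]`. -/
def H : PDSpace dX dY →L[ℝ] PDSpace dX dY :=
  blockMatrix (diagOp a.τ⁻¹) P.AT 0 (diagOp a.σ⁻¹)

/-- `M = [0, Aᵀ; -A, 0]`. -/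
def M : PDSpace dX dY →L[ℝ] PDSpace dX dY := blockMatrix 0 P.AT (-P.A) 0

/-- The rate `ρ`, for a subregularity constant `η` and a Lipschitz constant `βbar` of `∇ f`. -/
def rate (βbar η : ℝ) : ℝ :=
  min (pMin a) (C2Vt P a / (CV2 a *
    ((2 + 2 * cConst P a) + (1 + cConst P a) * (η * (‖H P a - M P‖ + βbar))) ^ 2))

/-- `u` is a Bregman-type projection of `(x, y)` onto the solution set: a minimizer of
`D_p(x; u) + V((x, y) - u)` over the solutions `u`. -/
def IsBregmanProj (x : BlockSpace dX) (y : BlockSpace dY) (u : PDSpace dX dY) : Prop :=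
  u ∈ P.solutions ∧ ∀ v ∈ P.solutions,
    P.Dp x u + V P a (pair x y - u) ≤ P.Dp x v + V P a (pair x y - v)

/-! ### The algorithm -/

open Classical in
/-- The random sequences `x, xbar, y, ybar` are generated by PURE-CD from the deterministic starting
point `(x0, y0)` and the random indices `idx`; the index `i_{k+1}` drawn at iteration `k` is
`idx k`. The values `xbar 0` and `ybar 0` play no role. -/
structure IsPureCD {Ω : Type*} (idx : ℕ → Ω → Fin n) (x0 : BlockSpace dX) (y0 : BlockSpace dY)
    (x xbar : ℕ → Ω → BlockSpace dX) (y ybar : ℕ → Ω → BlockSpace dY) : Prop where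
  init_x : ∀ ω, x 0 ω = x0
  init_y : ∀ ω, y 0 ω = y0
  ybar_step : ∀ k ω, IsProx a.σ (conjugate P.h) (y k ω + diagOp a.σ (P.A (x k ω)))
    (ybar (k + 1) ω)
  xbar_step : ∀ k ω, IsProx a.τ P.gSum
    (x k ω - diagOp a.τ (gradient P.f (x k ω) + P.AT (ybar (k + 1) ω))) (xbar (k + 1) ω)
  x_step : ∀ k ω i, x (k + 1) ω i = if i = idx k ω then xbar (k + 1) ω i else x k ω i
  y_step : ∀ k ω j, y (k + 1) ω j =
    if block P.A j (idx k ω) ≠ 0 then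
      ybar (k + 1) ω j + (a.σ j * theta P a j) • (P.A (x (k + 1) ω - x k ω)) j
    else y k ω j

end

end PureCD

end

/-!
# Linear convergence of PURE-CD under metric subregularity

*Structure of the solution set.* Zeros of the KKT operator are the saddle points of the Lagrangian
`f + g + ⟪A ·, ·⟫ - h^*` (`Problem.Standing.mem_solutions_iff_saddle`), so they form a closed convex
set, and on this set `D_p(x; ·)` is an affine function of the dual component
(`Problem.Standing.Dp_eq_add`). Hence `u ↦ D_p(x; u) + V(z - u)` is affine plus a positive definite
quadratic form on the solution set: it has a unique minimizer and grows quadratically around it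
(`IsBregmanProj.growth`). With Young's inequality the growth shows that the minimizer is, in the
weighted distance `V`, as close to `z` as any solution up to the factor `(1 + c)²`
(`IsBregmanProj.V_sub_le`).

*Descent.* Averaged over the sampled index, `D_p(·; u) + V(· - u)` at the next iterate is at most
`(1 - p_min) D_p(x; u) + V(z - u)` minus a multiple of the squared length of the full step
(`sum_mul_lyapunov_le`). The optimality condition of the primal proximal step is tested in each
block `i` with the weight `p_i - p_min` against `x_i`, and with the weight `p_min` against the
solution. The extrapolation `σ θ A (x_{k+1} - x_k)` in the dual update contributes the average
`⟪ȳ - u_y, A P (x̄ - x)⟫`, which turns `Aᵀ u_y` from `D_p` into `Aᵀ ȳ`, the vector that occurs in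
the proximal step.

*Subregularity.* The full proximal points have a KKT residual at most `‖H - M‖ + β̄` times the
length of the full step (`exists_mem_kkt_norm_le`), so metric subregularity bounds the distance of
`z` to the solution set, and therefore `V(z - z^⋆)`, by the full step (`rate_mul_V_le`). With
`u = z_k^⋆` in the descent inequality, and since `z_{k+1}^⋆` minimizes its own objective, the
expectation of `D_p(x_k; z_k^⋆) + V(z_k - z_k^⋆)` contracts by the factor `1 - ρ`
(`IsPureCD.integral_lyapunov_le`). Uniqueness of proximal points and of the projections makes all
quantities functions of the finitely many indices drawn so far, so that conditioning on the past
reduces to finite sums.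
-/

namespace PureCD

/-! ### Weighted norms on block spaces -/

section Blocks

variable {n : ℕ} {d : Fin n → ℕ}

@[simp] lemma diagOp_apply (w : Fin n → ℝ) (x : BlockSpace d) (i : Fin n) :
    diagOp w x i = w i • x i := rfl

lemma inner_diagOp (w : Fin n → ℝ) (x y : BlockSpace d) :
    ⟪diagOp w x, y⟫ = ∑ i, w i * ⟪x i, y i⟫ := by
  rw [PiLp.inner_apply]
  exact Finset.sum_congr rfl fun i _ => real_inner_smul_left _ _ _

lemma wNormSq_nonneg {w : Fin n → ℝ} (hw : ∀ i, 0 ≤ w i) (x : BlockSpace d) :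
    0 ≤ wNormSq w x :=
  Finset.sum_nonneg fun i _ => mul_nonneg (hw i) (sq_nonneg _)

lemma wNormSq_add_smul (w : Fin n → ℝ) (x y : BlockSpace d) (t : ℝ) :
    wNormSq w (x + t • y) = wNormSq w x + 2 * t * ⟪diagOp w x, y⟫ + t ^ 2 * wNormSq w y := by
  rw [inner_diagOp]
  simp only [wNormSq, Finset.mul_sum, ← Finset.sum_add_distrib]
  refine Finset.sum_congr rfl fun i _ => ?_
  rw [PiLp.add_apply, PiLp.smul_apply, norm_add_sq_real, norm_smul, real_inner_smul_right,
    mul_pow, Real.norm_eq_abs, sq_abs]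
  ring

lemma two_mul_inner_diagOp_sub (w : Fin n → ℝ) (x q u : BlockSpace d) :
    2 * ⟪diagOp w (x - q), u - q⟫ = wNormSq w (x - q) + wNormSq w (q - u) - wNormSq w (x - u) := by
  have h := wNormSq_add_smul w (x - q) (u - q) (-1)
  have e1 : x - q + (-1 : ℝ) • (u - q) = x - u := by simp
  have e2 : wNormSq w (u - q) = wNormSq w (q - u) := by
    simp [wNormSq, norm_sub_rev]
  rw [e1, e2] at h
  linarith

lemma wNormSq_neg (w : Fin n → ℝ) (x : BlockSpace d) : wNormSq w (-x) = wNormSq w x := by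
  simp [wNormSq]

lemma eq_zero_of_wNormSq_nonpos {w : Fin n → ℝ} (hw : ∀ i, 0 < w i) {x : BlockSpace d}
    (hx : wNormSq w x ≤ 0) : x = 0 := by
  have h0 : ∀ i ∈ Finset.univ, 0 ≤ w i * ‖x i‖ ^ 2 := fun i _ =>
    mul_nonneg (hw i).le (sq_nonneg _)
  have h1 := (Finset.sum_eq_zero_iff_of_nonneg h0).1 (le_antisymm hx (Finset.sum_nonneg h0))
  ext i : 1
  have := h1 i (Finset.mem_univ i)
  simpa [(hw i).ne'] using this

lemma mul_norm_sq_le_wNormSq {w : Fin n → ℝ} {c : ℝ} (hw : ∀ i, c ≤ w i) (x : BlockSpace d) :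
    c * ‖x‖ ^ 2 ≤ wNormSq w x := by
  rw [PiLp.norm_sq_eq_of_L2, Finset.mul_sum]
  exact Finset.sum_le_sum fun i _ => mul_le_mul_of_nonneg_right (hw i) (sq_nonneg _)

lemma wNormSq_le_mul_norm_sq {w : Fin n → ℝ} {c : ℝ} (hw : ∀ i, w i ≤ c) (x : BlockSpace d) :
    wNormSq w x ≤ c * ‖x‖ ^ 2 := by
  rw [PiLp.norm_sq_eq_of_L2, Finset.mul_sum]
  exact Finset.sum_le_sum fun i _ => mul_le_mul_of_nonneg_right (hw i) (sq_nonneg _)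

lemma continuous_wNormSq (w : Fin n → ℝ) : Continuous (wNormSq w : BlockSpace d → ℝ) := by
  unfold wNormSq
  fun_prop

/-- The vector `x` with its block `i` replaced by `v`. -/
def setBlock (i : Fin n) (v : EuclideanSpace ℝ (Fin (d i))) (x : BlockSpace d) : BlockSpace d :=
  WithLp.toLp 2 (Function.update x.ofLp i v)

@[simp] lemma setBlock_same (i : Fin n) (v : EuclideanSpace ℝ (Fin (d i))) (x : BlockSpace d) :
    setBlock i v x i = v := by
  simp [setBlock]

lemma setBlock_of_ne {i j : Fin n} (hj : j ≠ i) (v : EuclideanSpace ℝ (Fin (d i)))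
    (x : BlockSpace d) : setBlock i v x j = x j := by
  simp [setBlock, hj]

@[simp] lemma embed_same (i : Fin n) (v : EuclideanSpace ℝ (Fin (d i))) :
    (embed i v : BlockSpace d) i = v := by
  simp [embed]

lemma embed_of_ne {i j : Fin n} (hj : j ≠ i) (v : EuclideanSpace ℝ (Fin (d i))) :
    (embed i v : BlockSpace d) j = 0 := by
  simp [embed, hj]

lemma setBlock_eq_add_embed (i : Fin n) (v : EuclideanSpace ℝ (Fin (d i))) (x : BlockSpace d) :
    setBlock i v x = x + embed i (v - x i) := by
  ext j : 1
  by_cases hj : j = i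
  · subst hj
    rw [setBlock_same, PiLp.add_apply, embed_same, add_sub_cancel]
  · rw [setBlock_of_ne hj, PiLp.add_apply, embed_of_ne hj, add_zero]

/-- Sums over blocks of functions of `setBlock i v x` differ from those of `x` in one term. -/
lemma sum_setBlock (F : ∀ j, EuclideanSpace ℝ (Fin (d j)) → ℝ) (i : Fin n)
    (v : EuclideanSpace ℝ (Fin (d i))) (x : BlockSpace d) :
    ∑ j, F j (setBlock i v x j) = ∑ j, F j (x j) + (F i v - F i (x i)) := by
  have h : ∀ y : BlockSpace d, ∑ j, F j (y j) = F i (y i) + ∑ j ∈ Finset.univ.erase i, F j (y j) :=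
    fun y => (Finset.add_sum_erase _ _ (Finset.mem_univ i)).symm
  rw [h, h x, setBlock_same,
    Finset.sum_congr rfl fun j hj => by rw [setBlock_of_ne (Finset.ne_of_mem_erase hj)]]
  ring

lemma inner_embed_right (i : Fin n) (x : BlockSpace d) (v : EuclideanSpace ℝ (Fin (d i))) :
    ⟪x, embed i v⟫ = ⟪x i, v⟫ := by
  rw [PiLp.inner_apply, Finset.sum_eq_single i, embed_same]
  · intro j _ hj
    rw [embed_of_ne hj, inner_zero_right]
  · simp

end Blocks

/-! ### Extended-real-valued convex functions -/

section ConvexAnalysis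

variable {E : Type*} [NormedAddCommGroup E] [InnerProductSpace ℝ E]

lemma convex_epigraph_iff {φ : E → EReal} (hbot : ∀ x, φ x ≠ ⊥) :
    Convex ℝ {q : E × ℝ | φ q.1 ≤ (q.2 : EReal)} ↔
      ∀ x y, φ x ≠ ⊤ → φ y ≠ ⊤ → ∀ a b : ℝ, 0 ≤ a → 0 ≤ b → a + b = 1 →
        φ (a • x + b • y) ≤ ((a * (φ x).toReal + b * (φ y).toReal : ℝ) : EReal) := by
  constructor
  · intro h x y hx hy a b ha hb hab
    have hx' : (x, (φ x).toReal) ∈ {q : E × ℝ | φ q.1 ≤ (q.2 : EReal)} := by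
      simp [EReal.coe_toReal hx (hbot x)]
    have hy' : (y, (φ y).toReal) ∈ {q : E × ℝ | φ q.1 ≤ (q.2 : EReal)} := by
      simp [EReal.coe_toReal hy (hbot y)]
    exact h hx' hy' ha hb hab
  · rintro h ⟨x, r⟩ hx ⟨y, s⟩ hy a b ha hb hab
    simp only [Set.mem_ofPred_eq] at hx hy ⊢
    have hx' : φ x ≠ ⊤ := ne_top_of_le_ne_top (EReal.coe_ne_top r) hx
    have hy' : φ y ≠ ⊤ := ne_top_of_le_ne_top (EReal.coe_ne_top s) hy
    refine (h x y hx' hy' a b ha hb hab).trans ?_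
    have h1 : (φ x).toReal ≤ r := by
      rw [← EReal.coe_le_coe_iff, EReal.coe_toReal hx' (hbot x)]; exact hx
    have h2 : (φ y).toReal ≤ s := by
      rw [← EReal.coe_le_coe_iff, EReal.coe_toReal hy' (hbot y)]; exact hy
    rw [EReal.coe_le_coe_iff]
    simp only [Prod.snd_add, Prod.smul_snd, smul_eq_mul]
    gcongr

lemma ProperConvexLsc.coe_toReal {φ : E → EReal} (hφ : ProperConvexLsc φ) {x : E}
    (hx : φ x ≠ ⊤) : ((φ x).toReal : EReal) = φ x :=
  EReal.coe_toReal hx (hφ.ne_bot x)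

/-- Along a segment between points of the domain, a convex function stays finite and below
its chord. -/
lemma ProperConvexLsc.segment {φ : E → EReal} (hφ : ProperConvexLsc φ) {x y : E}
    (hx : φ x ≠ ⊤) (hy : φ y ≠ ⊤) {t : ℝ} (ht0 : 0 ≤ t) (ht1 : t ≤ 1) :
    φ (x + t • (y - x)) ≠ ⊤ ∧
      (φ (x + t • (y - x))).toReal ≤ (1 - t) * (φ x).toReal + t * (φ y).toReal := by
  have h := (convex_epigraph_iff hφ.ne_bot).1 hφ.convex x y hx hy (1 - t) t (by linarith) ht0
    (by ring)
  have e : (1 - t) • x + t • y = x + t • (y - x) := by module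
  rw [e] at h
  have h1 := ne_top_of_le_ne_top (EReal.coe_ne_top _) h
  refine ⟨h1, ?_⟩
  rwa [← hφ.coe_toReal h1, EReal.coe_le_coe_iff] at h

lemma ProperConvexLsc.mem_subdifferential_iff {φ : E → EReal} (hφ : ProperConvexLsc φ) {x v : E} :
    v ∈ subdifferential φ x ↔
      φ x ≠ ⊤ ∧ ∀ u, φ u ≠ ⊤ → (φ x).toReal + ⟪v, u - x⟫ ≤ (φ u).toReal := by
  refine and_congr_right fun hx => forall_congr' fun u => ?_
  by_cases hu : φ u = ⊤
  · simp [hu]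
  · rw [← hφ.coe_toReal hx, ← hφ.coe_toReal hu, ← EReal.coe_add, EReal.coe_le_coe_iff]
    simp

/-- A bound that holds up to an error linear in `t`, for all small `t`, holds without it. -/
lemma le_of_forall_le_add_mul {r s C : ℝ} (h : ∀ t : ℝ, 0 < t → t ≤ 1 → r ≤ s + t * C) :
    r ≤ s := by
  have hT : Filter.Tendsto (fun t : ℝ => s + t * C) (𝓝[>] 0) (𝓝 (s + 0 * C)) :=
    (Continuous.tendsto (by fun_prop) 0).mono_left nhdsWithin_le_nhds
  rw [zero_mul, add_zero] at hT
  refine ge_of_tendsto hT ?_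
  filter_upwards [Ioc_mem_nhdsGT (zero_lt_one' ℝ)] with t ht
  exact h t ht.1 ht.2

/-- Fermat's rule for the sum of a convex function and a function `q` whose increment from `x` is
bounded, up to second-order terms, by the linear function `⟪-v, ·⟫`. -/
lemma ProperConvexLsc.mem_subdifferential_of_isMin {φ : E → EReal} (hφ : ProperConvexLsc φ)
    {q : E → ℝ} {x v : E} (hx : φ x ≠ ⊤) (C : E → ℝ)
    (hmin : ∀ u, φ u ≠ ⊤ → (φ x).toReal + q x ≤ (φ u).toReal + q u)
    (hq : ∀ u (t : ℝ), 0 < t → t ≤ 1 →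
      q (x + t • (u - x)) ≤ q x - t * ⟪v, u - x⟫ + t ^ 2 * C u) :
    v ∈ subdifferential φ x := by
  refine hφ.mem_subdifferential_iff.2 ⟨hx, fun u hu => ?_⟩
  refine le_of_forall_le_add_mul (C := C u) fun t ht0 ht1 => ?_
  obtain ⟨h1, h2⟩ := hφ.segment hx hu ht0.le ht1
  have h3 := hmin _ h1
  have h4 := hq u t ht0 ht1
  refine le_of_mul_le_mul_left ?_ ht0
  nlinarith

lemma lowerSemicontinuous_add_of_ne_bot {α : Type*} [TopologicalSpace α] {φ ψ : α → EReal}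
    (hφ : LowerSemicontinuous φ) (hψ : LowerSemicontinuous ψ) (h1 : ∀ x, φ x ≠ ⊥)
    (h2 : ∀ x, ψ x ≠ ⊥) : LowerSemicontinuous fun x => φ x + ψ x :=
  hφ.add' hψ fun x => EReal.continuousAt_add (Or.inr (h2 x)) (Or.inl (h1 x))

lemma lowerSemicontinuous_conjugate (φ : E → EReal) : LowerSemicontinuous (conjugate φ) := by
  refine lowerSemicontinuous_iSup fun x => Continuous.lowerSemicontinuous ?_
  have h : Continuous fun v : E => ((⟪v, x⟫ : ℝ) : EReal) :=
    continuous_coe_real_ereal.comp (by fun_prop)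
  refine continuous_iff_continuousAt.2 fun v => ?_
  simp only [sub_eq_add_neg]
  exact (EReal.continuousAt_add (Or.inl (EReal.coe_ne_top _)) (Or.inl (EReal.coe_ne_bot _))).comp
    (h.continuousAt.prodMk continuousAt_const)

lemma ProperConvexLsc.conjugate {φ : E → EReal} (hφ : ProperConvexLsc φ)
    (hdom : ∃ v, conjugate φ v ≠ ⊤) : ProperConvexLsc (conjugate φ) := by
  have hbot : ∀ v, PureCD.conjugate φ v ≠ ⊥ := by
    intro v
    obtain ⟨x, hx⟩ := hφ.exists_ne_top
    have h := le_iSup (fun x => ((⟪v, x⟫ : ℝ) : EReal) - φ x) x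
    refine ne_bot_of_le_ne_bot ?_ h
    rw [← hφ.coe_toReal hx, ← EReal.coe_sub]
    exact EReal.coe_ne_bot _
  refine ⟨hbot, hdom, lowerSemicontinuous_conjugate φ, (convex_epigraph_iff hbot).2 ?_⟩
  intro v w hv hw a b ha hb hab
  refine iSup_le fun x => ?_
  by_cases hx : φ x = ⊤
  · simp [hx]
  have key : ∀ v, PureCD.conjugate φ v ≠ ⊤ →
      ⟪v, x⟫ - (φ x).toReal ≤ (PureCD.conjugate φ v).toReal := by
    intro v hv
    have h := le_iSup (fun x => ((⟪v, x⟫ : ℝ) : EReal) - φ x) x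
    change _ ≤ PureCD.conjugate φ v at h
    rwa [← EReal.coe_toReal hv (hbot v), ← hφ.coe_toReal hx, ← EReal.coe_sub,
      EReal.coe_le_coe_iff] at h
  rw [← hφ.coe_toReal hx, ← EReal.coe_sub, EReal.coe_le_coe_iff, inner_add_left,
    real_inner_smul_left, real_inner_smul_left]
  have e : a * ⟪v, x⟫ + b * ⟪w, x⟫ - (φ x).toReal =
      a * (⟪v, x⟫ - (φ x).toReal) + b * (⟪w, x⟫ - (φ x).toReal) := by
    linear_combination (φ x).toReal * hab
  rw [e]
  have := key v hv
  have := key w hw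
  gcongr

/-- Differentiable convex functions lie above their tangents. -/
lemma add_inner_gradient_le [CompleteSpace E] {f : E → ℝ} (hf : ConvexOn ℝ Set.univ f)
    (hd : Differentiable ℝ f) (x y : E) : f x + ⟪gradient f x, y - x⟫ ≤ f y := by
  have hφ : ConvexOn ℝ Set.univ (fun t : ℝ => f (x + t • (y - x))) := by
    have := hf.comp_affineMap (AffineMap.lineMap x y : ℝ →ᵃ[ℝ] E)
    have e : (f ∘ AffineMap.lineMap x y : ℝ → ℝ) = fun t : ℝ => f (x + t • (y - x)) := by
      funext t
      simp [AffineMap.lineMap_apply, add_comm]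
    rwa [Set.preimage_univ, e] at this
  have hder : HasDerivAt (fun t : ℝ => f (x + t • (y - x))) ⟪gradient f x, y - x⟫ 0 := by
    have h1 : HasDerivAt (fun t : ℝ => x + t • (y - x)) (y - x) 0 := by
      simpa using ((hasDerivAt_id (0 : ℝ)).smul_const (y - x)).const_add x
    have h2 : HasFDerivAt f (InnerProductSpace.toDual ℝ E (gradient f x))
        (x + (0 : ℝ) • (y - x)) := by
      simpa using (hd x).hasGradientAt.hasFDerivAt
    exact h2.comp_hasDerivAt (0 : ℝ) h1
  have := hφ.le_slope_of_hasDerivAt (Set.mem_univ 0) (Set.mem_univ 1) one_pos hder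
  simp only [slope_def_field, sub_zero, div_one, one_smul, zero_smul, add_zero,
    add_sub_cancel] at this
  linarith

end ConvexAnalysis

/-! ### Proximal points -/

section Prox

variable {n : ℕ} {d : Fin n → ℕ} {w : Fin n → ℝ} {φ : BlockSpace d → EReal}

/-- First-order optimality of proximal points. -/
lemma IsProx.mem_subdifferential (hφ : ProperConvexLsc φ)
    {x q : BlockSpace d} (h : IsProx w φ x q) : diagOp w⁻¹ (x - q) ∈ subdifferential φ q := by
  have hq : φ q ≠ ⊤ := by
    obtain ⟨u, hu⟩ := hφ.exists_ne_top
    intro hq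
    have h1 := h u
    rw [hq, EReal.top_add_coe, ← hφ.coe_toReal hu, ← EReal.coe_add, top_le_iff] at h1
    exact EReal.coe_ne_top _ h1
  refine hφ.mem_subdifferential_of_isMin (q := fun u => 1 / 2 * wNormSq w⁻¹ (u - x)) hq
    (fun u => 1 / 2 * wNormSq w⁻¹ (u - q)) (fun u hu => ?_) (fun u t _ _ => ?_)
  · have h1 := h u
    rw [← hφ.coe_toReal hu, ← hφ.coe_toReal hq, ← EReal.coe_add, ← EReal.coe_add,
      EReal.coe_le_coe_iff] at h1
    exact h1
  · have e : q + t • (u - q) - x = (q - x) + t • (u - q) := by abel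
    have e2 : diagOp w⁻¹ (x - q) = - diagOp w⁻¹ (q - x) := by rw [← map_neg, neg_sub]
    simp only [e, wNormSq_add_smul, e2, inner_neg_left]
    linarith

lemma IsProx.unique (hw : ∀ i, 0 < w i) (hφ : ProperConvexLsc φ) {x q q' : BlockSpace d}
    (h : IsProx w φ x q) (h' : IsProx w φ x q') : q = q' := by
  obtain ⟨h1, h2⟩ := hφ.mem_subdifferential_iff.1 (h.mem_subdifferential hφ)
  obtain ⟨h3, h4⟩ := hφ.mem_subdifferential_iff.1 (h'.mem_subdifferential hφ)
  have h5 := h2 q' h3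
  have h6 := h4 q h1
  have t1 := two_mul_inner_diagOp_sub w⁻¹ x q q'
  have t2 := two_mul_inner_diagOp_sub w⁻¹ x q' q
  have t3 : wNormSq w⁻¹ (q' - q) = wNormSq w⁻¹ (q - q') := by rw [← wNormSq_neg, neg_sub]
  have h7 : wNormSq w⁻¹ (q - q') ≤ 0 := by linarith
  exact sub_eq_zero.1 (eq_zero_of_wNormSq_nonpos (fun i => inv_pos.2 (hw i)) h7)

end Prox

/-! ### The set of primal-dual solutions -/

section Solutions

variable {n m : ℕ} {dX : Fin n → ℕ} {dY : Fin m → ℕ}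

@[simp] lemma pair_fst (x : BlockSpace dX) (y : BlockSpace dY) : (pair x y).fst = x := rfl

@[simp] lemma pair_snd (x : BlockSpace dX) (y : BlockSpace dY) : (pair x y).snd = y := rfl

lemma pair_add_pair (x x' : BlockSpace dX) (y y' : BlockSpace dY) :
    pair x y + pair x' y' = pair (x + x') (y + y') := rfl

lemma pair_sub_pair (x x' : BlockSpace dX) (y y' : BlockSpace dY) :
    pair x y - pair x' y' = pair (x - x') (y - y') := rfl

lemma pair_eq_zero_iff {x : BlockSpace dX} {y : BlockSpace dY} :
    pair x y = 0 ↔ x = 0 ∧ y = 0 := by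
  simp [pair, WithLp.toLp_eq_zero]

lemma fst_add_smul_sub (u v : PDSpace dX dY) (t : ℝ) :
    (u + t • (v - u)).fst = u.fst + t • (v.fst - u.fst) := rfl

lemma snd_add_smul_sub (u v : PDSpace dX dY) (t : ℝ) :
    (u + t • (v - u)).snd = u.snd + t • (v.snd - u.snd) := rfl

namespace Problem

variable {P : Problem dX dY} {β : Fin n → ℝ}

lemma inner_AT (P : Problem dX dY) (y : BlockSpace dY) (x : BlockSpace dX) :
    ⟪P.AT y, x⟫ = ⟪y, P.A x⟫ :=
  ContinuousLinearMap.adjoint_inner_left P.A x y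

lemma coe_sum_eq_sum_coe {ι : Type*} (s : Finset ι) (r : ι → ℝ) :
    ((∑ i ∈ s, r i : ℝ) : EReal) = ∑ i ∈ s, (r i : EReal) := by
  classical
  induction s using Finset.induction_on with
  | empty => simp
  | insert i s hi ih => rw [Finset.sum_insert hi, Finset.sum_insert hi, EReal.coe_add, ih]

lemma sum_ne_bot {ι : Type*} (s : Finset ι) {φ : ι → EReal} (h : ∀ i, φ i ≠ ⊥) :
    ∑ i ∈ s, φ i ≠ ⊥ := by
  classical
  induction s using Finset.induction_on with
  | empty => simp
  | insert i s hi ih =>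
    rw [Finset.sum_insert hi]
    exact EReal.add_ne_bot_iff.2 ⟨h i, ih⟩

lemma Standing.gSum_ne_bot (hP : P.Standing β) (x : BlockSpace dX) : P.gSum x ≠ ⊥ :=
  sum_ne_bot _ fun i => (hP.g_convex i).ne_bot _

lemma Standing.gSum_ne_top_iff (hP : P.Standing β) {x : BlockSpace dX} :
    P.gSum x ≠ ⊤ ↔ ∀ i, P.g i (x i) ≠ ⊤ := by
  constructor
  · intro h i hi
    refine h ?_
    rw [gSum, ← Finset.add_sum_erase _ _ (Finset.mem_univ i), hi]
    exact EReal.top_add_of_ne_bot (sum_ne_bot _ fun j => (hP.g_convex j).ne_bot _)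
  · intro h
    have : P.gSum x = ((∑ i, (P.g i (x i)).toReal : ℝ) : EReal) := by
      rw [gSum, coe_sum_eq_sum_coe]
      exact Finset.sum_congr rfl fun i _ => ((hP.g_convex i).coe_toReal (h i)).symm
    rw [this]
    exact EReal.coe_ne_top _

lemma Standing.toReal_gSum (hP : P.Standing β) {x : BlockSpace dX} (hx : P.gSum x ≠ ⊤) :
    (P.gSum x).toReal = ∑ i, (P.g i (x i)).toReal := by
  have h := hP.gSum_ne_top_iff.1 hx
  rw [← EReal.toReal_coe (∑ i, (P.g i (x i)).toReal), coe_sum_eq_sum_coe, gSum]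
  exact congrArg _ (Finset.sum_congr rfl fun i _ => ((hP.g_convex i).coe_toReal (h i)).symm)

lemma Standing.gSum_lsc (hP : P.Standing β) : LowerSemicontinuous P.gSum := by
  classical
  have h : ∀ s : Finset (Fin n), LowerSemicontinuous fun x : BlockSpace dX =>
      ∑ i ∈ s, P.g i (x i) := by
    intro s
    induction s using Finset.induction_on with
    | empty => simpa using lowerSemicontinuous_const
    | insert i s hi ih =>
      simp only [Finset.sum_insert hi]
      exact lowerSemicontinuous_add_of_ne_bot
        ((hP.g_convex i).lsc.comp (PiLp.continuous_apply 2 _ i)) ih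
        (fun _ => (hP.g_convex i).ne_bot _) fun _ => sum_ne_bot _ fun j => (hP.g_convex j).ne_bot _
  exact h Finset.univ

lemma Standing.gSum_properConvexLsc (hP : P.Standing β) : ProperConvexLsc P.gSum := by
  refine ⟨hP.gSum_ne_bot, ?_, hP.gSum_lsc, (convex_epigraph_iff hP.gSum_ne_bot).2 ?_⟩
  · choose x hx using fun i => (hP.g_convex i).exists_ne_top
    exact ⟨WithLp.toLp 2 x, hP.gSum_ne_top_iff.2 hx⟩
  · intro x y hx hy a b ha hb hab
    rw [hP.toReal_gSum hx, hP.toReal_gSum hy, Finset.mul_sum, Finset.mul_sum,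
      ← Finset.sum_add_distrib, coe_sum_eq_sum_coe]
    refine Finset.sum_le_sum fun i _ => ?_
    exact (convex_epigraph_iff (hP.g_convex i).ne_bot).1 (hP.g_convex i).convex _ _
      (hP.gSum_ne_top_iff.1 hx i) (hP.gSum_ne_top_iff.1 hy i) a b ha hb hab

lemma mem_solutions_iff {u : PDSpace dX dY} :
    u ∈ P.solutions ↔ -(gradient P.f u.fst + P.AT u.snd) ∈ subdifferential P.gSum u.fst ∧
      P.A u.fst ∈ subdifferential (conjugate P.h) u.snd := by
  constructor
  · rintro ⟨v, hv, s, hs, h⟩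
    obtain ⟨h1, h2⟩ := pair_eq_zero_iff.1 h.symm
    have e1 : -(gradient P.f u.fst + P.AT u.snd) = v := by
      rw [neg_eq_iff_add_eq_zero, ← h1]
      abel
    rw [e1, sub_eq_zero.1 h2]
    exact ⟨hv, hs⟩
  · rintro ⟨h1, h2⟩
    refine ⟨_, h1, _, h2, ?_⟩
    rw [eq_comm, pair_eq_zero_iff]
    constructor <;> abel

lemma Standing.conjugate_properConvexLsc (hP : P.Standing β) :
    ProperConvexLsc (conjugate P.h) := by
  obtain ⟨u, hu⟩ := hP.solutions_nonempty
  exact hP.h_convex.conjugate ⟨u.snd, (mem_solutions_iff.1 hu).2.1⟩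

lemma Standing.f_le_quadratic (hP : P.Standing β) {βbar : NNReal}
    (hβ : LipschitzWith βbar (gradient P.f)) (x v : BlockSpace dX) :
    P.f (x + v) ≤ P.f x + ⟪gradient P.f x, v⟫ + βbar * ‖v‖ ^ 2 := by
  have h1 := add_inner_gradient_le hP.f_convex hP.f_diff (x + v) x
  have h2 : ⟪gradient P.f (x + v) - gradient P.f x, v⟫ ≤ βbar * ‖v‖ ^ 2 := by
    refine (real_inner_le_norm _ _).trans ?_
    have := hβ.norm_sub_le (x + v) x
    rw [add_sub_cancel_left] at this
    calc _ ≤ βbar * ‖v‖ * ‖v‖ := by gcongr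
      _ = _ := by ring
  rw [sub_add_cancel_left, inner_neg_right] at h1
  rw [inner_sub_left] at h2
  linarith

lemma Standing.solution_primal_le (hP : P.Standing β) {u : PDSpace dX dY} (hu : u ∈ P.solutions)
    {x : BlockSpace dX} (hx : P.gSum x ≠ ⊤) :
    (P.gSum u.fst).toReal - ⟪gradient P.f u.fst, x - u.fst⟫ - ⟪u.snd, P.A (x - u.fst)⟫ ≤
      (P.gSum x).toReal := by
  have h := (hP.gSum_properConvexLsc.mem_subdifferential_iff.1 (mem_solutions_iff.1 hu).1).2 x hx
  rw [inner_neg_left, inner_add_left, inner_AT] at h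
  linarith

lemma Standing.solution_dual_le (hP : P.Standing β) {u : PDSpace dX dY} (hu : u ∈ P.solutions)
    {y : BlockSpace dY} (hy : conjugate P.h y ≠ ⊤) :
    (conjugate P.h u.snd).toReal + ⟪P.A u.fst, y - u.snd⟫ ≤ (conjugate P.h y).toReal :=
  (hP.conjugate_properConvexLsc.mem_subdifferential_iff.1 (mem_solutions_iff.1 hu).2).2 y hy

lemma Standing.solution_lagrangian_le (hP : P.Standing β) {u : PDSpace dX dY}
    (hu : u ∈ P.solutions) {x : BlockSpace dX} (hx : P.gSum x ≠ ⊤) :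
    P.f u.fst + (P.gSum u.fst).toReal - ⟪u.snd, P.A (x - u.fst)⟫ ≤
      P.f x + (P.gSum x).toReal := by
  have h1 := hP.solution_primal_le hu hx
  have h2 := add_inner_gradient_le hP.f_convex hP.f_diff u.fst x
  linarith

/-- Solutions are the saddle points of the Lagrangian `f + g + ⟪A ·, ·⟫ - h^*`. -/
lemma Standing.mem_solutions_iff_saddle (hP : P.Standing β) {βbar : NNReal}
    (hβ : LipschitzWith βbar (gradient P.f)) {u : PDSpace dX dY} :
    u ∈ P.solutions ↔ P.gSum u.fst ≠ ⊤ ∧ conjugate P.h u.snd ≠ ⊤ ∧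
      ∀ x y, P.gSum x ≠ ⊤ → conjugate P.h y ≠ ⊤ →
        (P.gSum u.fst).toReal + (conjugate P.h u.snd).toReal
          + (P.f u.fst + ⟪P.A u.fst, y⟫ - ⟪P.A x, u.snd⟫) ≤
        P.f x + (P.gSum x).toReal + (conjugate P.h y).toReal := by
  constructor
  · intro hu
    refine ⟨(mem_solutions_iff.1 hu).1.1, (mem_solutions_iff.1 hu).2.1, fun x y hx hy => ?_⟩
    have h1 := hP.solution_lagrangian_le hu hx
    have h2 := hP.solution_dual_le hu hy
    rw [map_sub, inner_sub_right, real_inner_comm, real_inner_comm (P.A u.fst)] at h1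
    rw [inner_sub_right] at h2
    linarith
  · rintro ⟨h1, h2, h3⟩
    refine mem_solutions_iff.2 ⟨?_, ?_⟩
    · refine hP.gSum_properConvexLsc.mem_subdifferential_of_isMin
        (q := fun x => P.f x + ⟪P.A x, u.snd⟫) h1 (fun x => βbar * ‖x - u.fst‖ ^ 2)
        (fun x hx => ?_) (fun x t _ _ => ?_)
      · have := h3 x u.snd hx h2
        linarith
      · have h4 := hP.f_le_quadratic hβ u.fst (t • (x - u.fst))
        simp only [inner_neg_left, inner_add_left, inner_AT, inner_smul_right, norm_smul, mul_pow,
          Real.norm_eq_abs, sq_abs, map_add, map_smul, real_inner_smul_left] at h4 ⊢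
        rw [real_inner_comm (P.A (x - u.fst)) u.snd]
        linarith
    · refine hP.conjugate_properConvexLsc.mem_subdifferential_iff.2 ⟨h2, fun y hy => ?_⟩
      have := h3 u.fst y h1 hy
      rw [inner_sub_right]
      linarith

lemma Standing.convex_solutions (hP : P.Standing β) {βbar : NNReal}
    (hβ : LipschitzWith βbar (gradient P.f)) {u v : PDSpace dX dY} (hu : u ∈ P.solutions)
    (hv : v ∈ P.solutions) {t : ℝ} (ht0 : 0 ≤ t) (ht1 : t ≤ 1) :
    u + t • (v - u) ∈ P.solutions := by
  obtain ⟨u1, u2, u3⟩ := (hP.mem_solutions_iff_saddle hβ).1 hu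
  obtain ⟨v1, v2, v3⟩ := (hP.mem_solutions_iff_saddle hβ).1 hv
  obtain ⟨g1, g2⟩ := hP.gSum_properConvexLsc.segment u1 v1 ht0 ht1
  obtain ⟨c1, c2⟩ := hP.conjugate_properConvexLsc.segment u2 v2 ht0 ht1
  refine (hP.mem_solutions_iff_saddle hβ).2 ⟨g1, c1, fun x y hx hy => ?_⟩
  have hf := hP.f_convex.2 (Set.mem_univ u.fst) (Set.mem_univ v.fst) (sub_nonneg.2 ht1) ht0
    (by ring)
  have e : (1 - t) • u.fst + t • v.fst = u.fst + t • (v.fst - u.fst) := by module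
  rw [e, smul_eq_mul, smul_eq_mul] at hf
  have hu' := mul_le_mul_of_nonneg_left (u3 x y hx hy) (sub_nonneg.2 ht1)
  have hv' := mul_le_mul_of_nonneg_left (v3 x y hx hy) ht0
  rw [fst_add_smul_sub, snd_add_smul_sub]
  simp only [map_add, map_smul, map_sub, inner_add_left, inner_add_right, real_inner_smul_left,
    inner_sub_left, inner_sub_right, inner_smul_right]
  linarith

lemma Standing.isClosed_solutions (hP : P.Standing β) {βbar : NNReal}
    (hβ : LipschitzWith βbar (gradient P.f)) : IsClosed P.solutions := by
  have hg := hP.gSum_properConvexLsc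
  have hc := hP.conjugate_properConvexLsc
  -- the defining inequalities of saddle points, as extended-real inequalities
  have e : P.solutions = ⋂ (x) (y) (_ : P.gSum x ≠ ⊤) (_ : conjugate P.h y ≠ ⊤),
      {u : PDSpace dX dY | P.gSum u.fst + conjugate P.h u.snd
        + ((P.f u.fst + ⟪P.A u.fst, y⟫ - ⟪P.A x, u.snd⟫ : ℝ) : EReal) ≤
          ((P.f x + (P.gSum x).toReal + (conjugate P.h y).toReal : ℝ) : EReal)} := by
    ext u
    simp only [Set.mem_iInter, Set.mem_ofPred_eq]
    rw [hP.mem_solutions_iff_saddle hβ]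
    constructor
    · rintro ⟨h1, h2, h3⟩ x y hx hy
      rw [← hg.coe_toReal h1, ← hc.coe_toReal h2, ← EReal.coe_add, ← EReal.coe_add,
        EReal.coe_le_coe_iff]
      exact h3 x y hx hy
    · intro h
      have hfin : P.gSum u.fst ≠ ⊤ ∧ conjugate P.h u.snd ≠ ⊤ := by
        obtain ⟨x, hx⟩ := hg.exists_ne_top
        obtain ⟨y, hy⟩ := hc.exists_ne_top
        have h0 := ne_top_of_le_ne_top (EReal.coe_ne_top _) (h x y hx hy)
        constructor
        · intro h1
          rw [h1, EReal.top_add_of_ne_bot (hc.ne_bot _), EReal.top_add_coe] at h0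
          exact h0 rfl
        · intro h1
          rw [h1, EReal.add_top_of_ne_bot (hg.ne_bot _), EReal.top_add_coe] at h0
          exact h0 rfl
      obtain ⟨h1, h2⟩ := hfin
      refine ⟨h1, h2, fun x y hx hy => ?_⟩
      have h3 := h x y hx hy
      rwa [← hg.coe_toReal h1, ← hc.coe_toReal h2, ← EReal.coe_add, ← EReal.coe_add,
        EReal.coe_le_coe_iff] at h3
  rw [e]
  refine isClosed_iInter fun x => isClosed_iInter fun y => isClosed_iInter fun _ =>
    isClosed_iInter fun _ => ?_
  have cf : Continuous P.f := hP.f_diff.continuous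
  have c1 : Continuous fun u : PDSpace dX dY => u.fst := WithLp.continuous_fst 2 _ _
  have c2 : Continuous fun u : PDSpace dX dY => u.snd := WithLp.continuous_snd 2 _ _
  refine (lowerSemicontinuous_add_of_ne_bot (lowerSemicontinuous_add_of_ne_bot
    (hg.lsc.comp c1) (hc.lsc.comp c2) (fun _ => hg.ne_bot _)
    fun _ => hc.ne_bot _) (Continuous.lowerSemicontinuous (continuous_coe_real_ereal.comp ?_))
    (fun u => EReal.add_ne_bot_iff.2 ⟨hg.ne_bot _, hc.ne_bot _⟩)
    fun u => EReal.coe_ne_bot _).isClosed_preimage _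
  fun_prop

lemma Standing.Dp_nonneg (hP : P.Standing β) {x : BlockSpace dX} (hx : P.gSum x ≠ ⊤)
    {u : PDSpace dX dY} (hu : u ∈ P.solutions) : 0 ≤ P.Dp x u := by
  have h := hP.solution_lagrangian_le hu hx
  rw [Dp, inner_AT]
  linarith

/-- On the solution set, `D_p(x; ·)` is an affine function of the dual component: `f + g` and `h^*`
are affine on the projections of the solution set. -/
lemma Standing.Dp_eq_add (hP : P.Standing β) (x : BlockSpace dX) {u v : PDSpace dX dY}
    (hu : u ∈ P.solutions) (hv : v ∈ P.solutions) :
    P.Dp x u = P.Dp x v + ⟪u.snd - v.snd, P.A (x - v.fst)⟫ := by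
  have u1 := (mem_solutions_iff.1 hu).1.1
  have u2 := (mem_solutions_iff.1 hu).2.1
  have v1 := (mem_solutions_iff.1 hv).1.1
  have v2 := (mem_solutions_iff.1 hv).2.1
  have h1 := hP.solution_lagrangian_le hu v1
  have h2 := hP.solution_lagrangian_le hv u1
  have h3 := hP.solution_dual_le hu v2
  have h4 := hP.solution_dual_le hv u2
  rw [real_inner_comm] at h3 h4
  simp only [Dp, inner_AT]
  simp only [map_sub, inner_sub_left, inner_sub_right] at *
  linarith

end Problem

end Solutions

/-! ### Parameters and constants -/

section Constants

variable {n m : ℕ} {dX : Fin n → ℕ} {dY : Fin m → ℕ} {P : Problem dX dY} {a : Params n m}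

lemma Params.Admissible.nonempty (ha : a.Admissible P) : Nonempty (Fin n) := by
  by_contra h
  rw [not_nonempty_iff] at h
  simpa using ha.p_sum

lemma pMin_le (a : Params n m) (i : Fin n) : pMin a ≤ a.p i :=
  ciInf_le (Set.finite_range _).bddBelow i

lemma Params.Admissible.pMin_pos (ha : a.Admissible P) : 0 < pMin a := by
  have := ha.nonempty
  obtain ⟨i, hi⟩ := exists_eq_ciInf_of_finite (f := a.p)
  rw [pMin, ← hi]
  exact ha.p_pos i

lemma Params.Admissible.pMin_le_one (ha : a.Admissible P) : pMin a ≤ 1 := by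
  obtain ⟨i⟩ := ha.nonempty
  refine (pMin_le a i).trans ?_
  rw [← ha.p_sum]
  exact Finset.single_le_sum (fun j _ => (ha.p_pos j).le) (Finset.mem_univ i)

lemma Params.Admissible.pMin_le_piW (ha : a.Admissible P) (hrow : ∀ j, ∃ i, block P.A j i ≠ 0)
    (j : Fin m) : pMin a ≤ piW P a j := by
  classical
  obtain ⟨i, hi⟩ := hrow j
  refine (pMin_le a i).trans ?_
  unfold piW
  exact Finset.single_le_sum (f := a.p) (fun j _ => (ha.p_pos j).le)
    (Finset.mem_filter.2 ⟨Finset.mem_univ i, hi⟩)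

lemma Params.Admissible.piW_pos (ha : a.Admissible P) (hrow : ∀ j, ∃ i, block P.A j i ≠ 0)
    (j : Fin m) : 0 < piW P a j :=
  ha.pMin_pos.trans_le (ha.pMin_le_piW hrow j)

/-- The step size condition says precisely that the constants `C(τ)_i` are positive. -/
lemma Params.Admissible.Ctau_pos (ha : a.Admissible P) (hrow : ∀ j, ∃ i, block P.A j i ≠ 0)
    (i : Fin n) : 0 < Ctau P a i := by
  have hp := ha.pMin_pos
  have hτ := ha.τ_pos i
  have e : ∑ j, (piW P a j)⁻¹ * a.σ j * theta P a j ^ 2 * ‖block P.A j i‖ ^ 2 =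
      (pMin a)⁻¹ ^ 2 * ∑ j, piW P a j * a.σ j * ‖block P.A j i‖ ^ 2 := by
    rw [Finset.mul_sum]
    refine Finset.sum_congr rfl fun j _ => ?_
    have := (ha.piW_pos hrow j).ne'
    rw [theta]
    field_simp
  have e2 : Ctau P a i = (pMin a * a.τ i)⁻¹ * (2 * a.p i - pMin a - a.τ i * (a.β i * a.p i
      + (pMin a)⁻¹ * a.p i * ∑ j, piW P a j * a.σ j * ‖block P.A j i‖ ^ 2)) := by
    rw [Ctau, e]
    field_simp
    ring
  rw [e2]
  have := ha.step i
  have : 0 < 2 * a.p i - pMin a - a.τ i * (a.β i * a.p i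
      + (pMin a)⁻¹ * a.p i * ∑ j, piW P a j * a.σ j * ‖block P.A j i‖ ^ 2) := by linarith
  positivity

lemma ciInf_pos_of_finite {ι : Type*} [Finite ι] [Nonempty ι] {r : ι → ℝ} (h : ∀ i, 0 < r i) :
    0 < ⨅ i, r i := by
  obtain ⟨i, hi⟩ := exists_eq_ciInf_of_finite (f := r)
  rw [← hi]
  exact h i

lemma Params.Admissible.C2Vt_pos [NeZero m] (ha : a.Admissible P)
    (hrow : ∀ j, ∃ i, block P.A j i ≠ 0) :
    0 < C2Vt P a := by
  have := ha.nonempty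
  have := ha.pMin_pos
  have := ciInf_pos_of_finite (ha.Ctau_pos hrow)
  have := ciInf_pos_of_finite fun j => inv_pos.2 (ha.σ_pos j)
  unfold C2Vt
  positivity

lemma C2Vt_le_Ctau (ha : a.Admissible P) (i : Fin n) : C2Vt P a ≤ pMin a / 2 * Ctau P a i :=
  mul_le_mul_of_nonneg_left ((min_le_left _ _).trans (ciInf_le (Set.finite_range _).bddBelow i))
    (by linarith [ha.pMin_pos])

lemma C2Vt_le_inv_σ (ha : a.Admissible P) (j : Fin m) : C2Vt P a ≤ pMin a / 2 * (a.σ j)⁻¹ :=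
  mul_le_mul_of_nonneg_left ((min_le_right _ _).trans (ciInf_le (Set.finite_range _).bddBelow j))
    (by linarith [ha.pMin_pos])

lemma inv_τ_le_CV2 (a : Params n m) (i : Fin n) : 1 / 2 * (a.τ i)⁻¹ ≤ CV2 a := by
  refine mul_le_mul_of_nonneg_left (le_trans ?_ (le_max_left _ _)) (by norm_num)
  rw [← one_div]
  exact le_ciSup (f := fun i => 1 / a.τ i) (Set.finite_range _).bddAbove i

lemma inv_σ_le_CV2 (a : Params n m) (j : Fin m) : 1 / 2 * (a.σ j)⁻¹ ≤ CV2 a := by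
  refine mul_le_mul_of_nonneg_left (le_trans ?_ (le_max_right _ _)) (by norm_num)
  rw [← one_div]
  exact le_ciSup (f := fun i => 1 / a.σ i) (Set.finite_range _).bddAbove j

lemma Params.Admissible.C2Vt_le_CV2 [NeZero m] (ha : a.Admissible P) : C2Vt P a ≤ CV2 a := by
  have h1 := C2Vt_le_inv_σ ha 0
  have h2 := inv_σ_le_CV2 a 0
  have h3 := inv_pos.2 (ha.σ_pos 0)
  have h4 := ha.pMin_le_one
  nlinarith

lemma Params.Admissible.CV2_pos [NeZero m] (ha : a.Admissible P) : 0 < CV2 a := by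
  have h2 := inv_σ_le_CV2 a 0
  have h3 := inv_pos.2 (ha.σ_pos 0)
  linarith

lemma cConst_nonneg (P : Problem dX dY) (a : Params n m) : 0 ≤ cConst P a := by
  unfold cConst
  positivity

lemma Params.Admissible.rate_pos [NeZero m] (ha : a.Admissible P)
    (hrow : ∀ j, ∃ i, block P.A j i ≠ 0)
    {βbar η : ℝ} (hβ : 0 ≤ βbar) (hη : 0 < η) : 0 < rate P a βbar η := by
  have := ha.pMin_pos
  have := ha.C2Vt_pos hrow
  have := ha.CV2_pos
  have := cConst_nonneg P a
  unfold rate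
  positivity

lemma Params.Admissible.rate_lt_one [NeZero m] (ha : a.Admissible P) {βbar η : ℝ} (hβ : 0 ≤ βbar)
    (hη : 0 < η) : rate P a βbar η < 1 := by
  have h1 := ha.C2Vt_le_CV2
  have h2 := ha.CV2_pos
  have h3 := cConst_nonneg P a
  refine (min_le_right _ _).trans_lt ?_
  have h4 : 0 ≤ η * (‖H P a - M P‖ + βbar) := by positivity
  have h5 : 2 ≤ (2 + 2 * cConst P a) + (1 + cConst P a) * (η * (‖H P a - M P‖ + βbar)) := by
    nlinarith [mul_nonneg h3 h4]
  rw [div_lt_one (by positivity)]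
  have h6 := mul_le_mul_of_nonneg_left (pow_le_pow_left₀ zero_le_two h5 2) h2.le
  linarith

/-! ### The weighted distance `V` -/

lemma Params.Admissible.V_nonneg (ha : a.Admissible P) (hrow : ∀ j, ∃ i, block P.A j i ≠ 0)
    (z : PDSpace dX dY) : 0 ≤ V P a z := by
  have hp := ha.pMin_pos
  have h1 : 0 ≤ wNormSq (fun i => (a.τ i)⁻¹ * (a.p i)⁻¹) z.fst := wNormSq_nonneg
    (fun i => (mul_pos (inv_pos.2 (ha.τ_pos i)) (inv_pos.2 (ha.p_pos i))).le) _
  have h2 : 0 ≤ wNormSq (fun j => (a.σ j)⁻¹ * (piW P a j)⁻¹) z.snd := wNormSq_nonneg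
    (fun j => (mul_pos (inv_pos.2 (ha.σ_pos j)) (inv_pos.2 (ha.piW_pos hrow j))).le) _
  unfold V
  positivity

lemma continuous_V (P : Problem dX dY) (a : Params n m) : Continuous (V P a) := by
  have c1 : Continuous fun u : PDSpace dX dY => u.fst := WithLp.continuous_fst 2 _ _
  have c2 : Continuous fun u : PDSpace dX dY => u.snd := WithLp.continuous_snd 2 _ _
  exact (continuous_const.mul ((continuous_wNormSq _).comp c1)).add
    (continuous_const.mul ((continuous_wNormSq _).comp c2))

lemma wNormSq_sub_segment {k : ℕ} {d : Fin k → ℕ} (w : Fin k → ℝ) (z u v : BlockSpace d) (t : ℝ) :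
    wNormSq w (z - (u + t • (v - u))) =
      (1 - t) * wNormSq w (z - u) + t * wNormSq w (z - v) - t * (1 - t) * wNormSq w (v - u) := by
  have e : z - (u + t • (v - u)) = (z - u) + (-t) • (v - u) := by module
  have h1 := two_mul_inner_diagOp_sub w z u v
  have h2 := wNormSq_neg w (v - u)
  rw [neg_sub] at h2
  rw [e, wNormSq_add_smul]
  linear_combination -t * h1 - t * h2

lemma V_sub_segment (P : Problem dX dY) (a : Params n m) (z u v : PDSpace dX dY) (t : ℝ) :
    V P a (z - (u + t • (v - u))) =
      (1 - t) * V P a (z - u) + t * V P a (z - v) - t * (1 - t) * V P a (v - u) := by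
  have h1 := wNormSq_sub_segment (fun i => (a.τ i)⁻¹ * (a.p i)⁻¹) z.fst u.fst v.fst t
  have h2 := wNormSq_sub_segment (fun j => (a.σ j)⁻¹ * (piW P a j)⁻¹) z.snd u.snd v.snd t
  simp only [V, WithLp.sub_fst, WithLp.sub_snd, fst_add_smul_sub, snd_add_smul_sub]
  linear_combination pMin a / 2 * h1 + pMin a / 2 * h2

lemma Params.Admissible.V_le (ha : a.Admissible P) (hrow : ∀ j, ∃ i, block P.A j i ≠ 0)
    (z : PDSpace dX dY) : V P a z ≤ CV2 a * ‖z‖ ^ 2 := by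
  have hp := ha.pMin_pos
  have h1 := wNormSq_le_mul_norm_sq (c := 2 / pMin a * CV2 a)
    (w := fun i => (a.τ i)⁻¹ * (a.p i)⁻¹) (fun i => by
      have hi := ha.p_pos i
      have h1 : (a.p i)⁻¹ ≤ (pMin a)⁻¹ := inv_anti₀ hp (pMin_le a i)
      have h2 := inv_τ_le_CV2 a i
      have h3 := inv_pos.2 (ha.τ_pos i)
      have h4 := inv_pos.2 hp
      calc (a.τ i)⁻¹ * (a.p i)⁻¹ ≤ (a.τ i)⁻¹ * (pMin a)⁻¹ := by gcongr
        _ = 2 * (pMin a)⁻¹ * (1 / 2 * (a.τ i)⁻¹) := by ring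
        _ ≤ 2 * (pMin a)⁻¹ * CV2 a := by gcongr) z.fst
  have h2 := wNormSq_le_mul_norm_sq (c := 2 / pMin a * CV2 a)
    (w := fun j => (a.σ j)⁻¹ * (piW P a j)⁻¹) (fun j => by
      have h1 : (piW P a j)⁻¹ ≤ (pMin a)⁻¹ := inv_anti₀ hp (ha.pMin_le_piW hrow j)
      have h2 := inv_σ_le_CV2 a j
      have h3 := inv_pos.2 (ha.σ_pos j)
      have h4 := inv_pos.2 hp
      calc (a.σ j)⁻¹ * (piW P a j)⁻¹ ≤ (a.σ j)⁻¹ * (pMin a)⁻¹ := by gcongr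
        _ = 2 * (pMin a)⁻¹ * (1 / 2 * (a.σ j)⁻¹) := by ring
        _ ≤ 2 * (pMin a)⁻¹ * CV2 a := by gcongr) z.snd
  rw [V, WithLp.prod_norm_sq_eq_of_L2]
  calc _ ≤ pMin a / 2 * (2 / pMin a * CV2 a * ‖z.fst‖ ^ 2)
        + pMin a / 2 * (2 / pMin a * CV2 a * ‖z.snd‖ ^ 2) := by gcongr
    _ = _ := by
      field_simp

lemma Params.Admissible.norm_sq_le [NeZero m] (ha : a.Admissible P)
    (hrow : ∀ j, ∃ i, block P.A j i ≠ 0)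
    (z : PDSpace dX dY) : ‖z‖ ^ 2 ≤ C2V P a ^ 2 * V P a z := by
  have := ha.nonempty
  have hp := ha.pMin_pos
  set l := min (⨅ i, (a.τ i)⁻¹ * (a.p i)⁻¹) (⨅ j, (a.σ j)⁻¹ * (piW P a j)⁻¹) with hl
  have hl0 : 0 < l := lt_min
    (ciInf_pos_of_finite fun i => mul_pos (inv_pos.2 (ha.τ_pos i)) (inv_pos.2 (ha.p_pos i)))
    (ciInf_pos_of_finite fun j => mul_pos (inv_pos.2 (ha.σ_pos j))
      (inv_pos.2 (ha.piW_pos hrow j)))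
  have h1 := mul_norm_sq_le_wNormSq (c := l) (w := fun i => (a.τ i)⁻¹ * (a.p i)⁻¹)
    (fun i => (min_le_left _ _).trans (ciInf_le (Set.finite_range _).bddBelow i)) z.fst
  have h2 := mul_norm_sq_le_wNormSq (c := l) (w := fun j => (a.σ j)⁻¹ * (piW P a j)⁻¹)
    (fun j => (min_le_right _ _).trans (ciInf_le (Set.finite_range _).bddBelow j)) z.snd
  rw [C2V, Real.sq_sqrt (by positivity), ← hl, V, WithLp.prod_norm_sq_eq_of_L2]
  calc _ = 2 / (pMin a * l) *
        (pMin a / 2 * (l * ‖z.fst‖ ^ 2) + pMin a / 2 * (l * ‖z.snd‖ ^ 2)) := by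
        field_simp
    _ ≤ _ := by gcongr

/-! ### Bregman-type projections onto the solution set -/

variable {βbar : NNReal}

lemma exists_isBregmanProj [NeZero m] (hP : P.Standing a.β) (ha : a.Admissible P)
    (hrow : ∀ j, ∃ i, block P.A j i ≠ 0)
    (hβ : LipschitzWith βbar (gradient P.f)) {x : BlockSpace dX}
    (hx : P.gSum x ≠ ⊤) (y : BlockSpace dY) : ∃ u, IsBregmanProj P a x y u := by
  obtain ⟨v, hv⟩ := hP.solutions_nonempty
  set z := pair x y with hz
  set Q : PDSpace dX dY → ℝ := fun u =>
    P.Dp x v + ⟪u.snd - v.snd, P.A (x - v.fst)⟫ + V P a (z - u) with hQ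
  have hQs : ∀ u ∈ P.solutions, Q u = P.Dp x u + V P a (z - u) := fun u hu => by
    rw [hP.Dp_eq_add x hu hv]
  have hcont : Continuous Q := by
    have c2 : Continuous fun u : PDSpace dX dY => u.snd := WithLp.continuous_snd 2 _ _
    have c3 := continuous_V P a
    fun_prop
  -- outside of a large ball the objective exceeds its value at `v`
  set R := √(C2V P a ^ 2 * Q v)
  have hQv : 0 ≤ Q v := by
    rw [hQs v hv]
    exact add_nonneg (hP.Dp_nonneg hx hv) (ha.V_nonneg hrow _)
  have hball : ∀ u ∈ P.solutions, Q u ≤ Q v → u ∈ Metric.closedBall z R := by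
    intro u hu hle
    rw [Metric.mem_closedBall, dist_comm, dist_eq_norm]
    refine Real.le_sqrt_of_sq_le ((ha.norm_sq_le hrow _).trans ?_)
    refine mul_le_mul_of_nonneg_left (le_trans ?_ hle) (sq_nonneg _)
    rw [hQs u hu]
    linarith [hP.Dp_nonneg hx hu]
  obtain ⟨u, hu, hmin⟩ := ((isCompact_closedBall z R).inter_left
    (hP.isClosed_solutions hβ)).exists_isMinOn ⟨v, hv, hball v hv le_rfl⟩ hcont.continuousOn
  refine ⟨u, hu.1, fun w hw => ?_⟩
  rw [← hQs u hu.1, ← hQs w hw]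
  by_cases h : Q w ≤ Q v
  · exact hmin ⟨hw, hball w hw h⟩
  · exact (hmin ⟨hv, hball v hv le_rfl⟩).trans (not_le.1 h).le

/-- Quadratic growth of the objective of the Bregman-type projection: it is the sum of an affine
function and of `V` on the solution set. -/
lemma IsBregmanProj.growth (hP : P.Standing a.β)
    (hβ : LipschitzWith βbar (gradient P.f)) {x : BlockSpace dX}
    {y : BlockSpace dY} {u v : PDSpace dX dY} (hu : IsBregmanProj P a x y u)
    (hv : v ∈ P.solutions) :
    P.Dp x u + V P a (pair x y - u) + V P a (v - u) ≤ P.Dp x v + V P a (pair x y - v) := by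
  refine le_of_forall_le_add_mul (C := V P a (v - u)) fun t ht0 ht1 => ?_
  have hs := hP.convex_solutions hβ hu.1 hv ht0.le ht1
  have h1 := hu.2 _ hs
  rw [V_sub_segment, hP.Dp_eq_add x hs hu.1] at h1
  have h2 := hP.Dp_eq_add x hv hu.1
  have e : (u + t • (v - u)).snd - u.snd = t • (v.snd - u.snd) := by
    rw [snd_add_smul_sub, add_sub_cancel_left]
  rw [e, real_inner_smul_left] at h1
  refine le_of_mul_le_mul_left ?_ ht0
  rw [h2]
  linarith

lemma IsBregmanProj.unique [NeZero m] (hP : P.Standing a.β) (ha : a.Admissible P)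
    (hrow : ∀ j, ∃ i, block P.A j i ≠ 0)
    (hβ : LipschitzWith βbar (gradient P.f)) {x : BlockSpace dX}
    {y : BlockSpace dY} {u v : PDSpace dX dY}
    (hu : IsBregmanProj P a x y u) (hv : IsBregmanProj P a x y v) : u = v := by
  have h1 := hu.growth hP hβ hv.1
  have h2 := hv.2 u hu.1
  have h3 := ha.norm_sq_le hrow (v - u)
  have h4 := ha.V_nonneg hrow (v - u)
  have h5 : V P a (v - u) = 0 := by linarith
  rw [h5, mul_zero] at h3
  have h6 : ‖v - u‖ = 0 := by nlinarith [norm_nonneg (v - u)]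
  exact (sub_eq_zero.1 (norm_eq_zero.1 h6)).symm

/-- In the weighted distance, the Bregman-type projection is a quasi-optimal approximation. -/
lemma IsBregmanProj.V_sub_le [NeZero m] (hP : P.Standing a.β) (ha : a.Admissible P)
    (hrow : ∀ j, ∃ i, block P.A j i ≠ 0)
    (hβ : LipschitzWith βbar (gradient P.f)) {x : BlockSpace dX}
    {y : BlockSpace dY} {u e : PDSpace dX dY} (hu : IsBregmanProj P a x y u)
    (he : e ∈ P.solutions) :
    V P a (pair x y - u) ≤ (1 + cConst P a) ^ 2 * V P a (pair x y - e) := by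
  set z := pair x y with hz
  have h1 := hu.growth hP hβ he
  rw [hP.Dp_eq_add x hu.1 he, ← hz] at h1
  have hV1 := ha.V_nonneg hrow (z - e)
  have hV2 := ha.V_nonneg hrow (e - u)
  have hc := cConst_nonneg P a
  have hn1 : ‖x - e.fst‖ ≤ ‖z - e‖ := by
    refine abs_le_of_sq_le_sq' ?_ (norm_nonneg _) |>.2
    rw [WithLp.prod_norm_sq_eq_of_L2]
    exact le_add_of_nonneg_right (sq_nonneg _)
  have hn2 : ‖u.snd - e.snd‖ ≤ ‖e - u‖ := by
    refine abs_le_of_sq_le_sq' ?_ (norm_nonneg _) |>.2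
    rw [WithLp.prod_norm_sq_eq_of_L2, norm_sub_rev]
    exact le_add_of_nonneg_left (sq_nonneg _)
  have hin : -⟪u.snd - e.snd, P.A (x - e.fst)⟫ ≤ ‖P.A‖ * ‖z - e‖ * ‖e - u‖ := by
    refine (neg_le_abs _).trans ((abs_real_inner_le_norm _ _).trans ?_)
    calc ‖u.snd - e.snd‖ * ‖P.A (x - e.fst)‖
        ≤ ‖u.snd - e.snd‖ * (‖P.A‖ * ‖x - e.fst‖) := by gcongr; exact P.A.le_opNorm _
      _ ≤ ‖e - u‖ * (‖P.A‖ * ‖z - e‖) := by gcongr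
      _ = _ := by ring
  -- Young's inequality, with `‖·‖² ≤ C_{2,V}² V`
  have hy : ‖P.A‖ * ‖z - e‖ * ‖e - u‖ ≤ cConst P a ^ 2 * V P a (z - e) + V P a (e - u) := by
    refine (abs_le_of_sq_le_sq' ?_ (by positivity)).2
    calc (‖P.A‖ * ‖z - e‖ * ‖e - u‖) ^ 2 = ‖P.A‖ ^ 2 * (‖z - e‖ ^ 2 * ‖e - u‖ ^ 2) := by ring
      _ ≤ ‖P.A‖ ^ 2 * ((C2V P a ^ 2 * V P a (z - e)) * (C2V P a ^ 2 * V P a (e - u))) := by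
          gcongr <;> exact ha.norm_sq_le hrow _
      _ = 4 * cConst P a ^ 2 * V P a (z - e) * V P a (e - u) := by rw [cConst]; ring
      _ ≤ _ := by nlinarith [sq_nonneg (cConst P a ^ 2 * V P a (z - e) - V P a (e - u))]
  nlinarith [mul_nonneg hc hV1]

end Constants

/-! ### One iteration, as a deterministic function of the sampled index -/

section OneStep

variable {n m : ℕ} {dX : Fin n → ℕ} {dY : Fin m → ℕ} {P : Problem dX dY} {a : Params n m}

open Classical in
/-- The dual iterate that follows `(x, y)` when the index `i` is drawn and the full proximal points
are `(xb, yb)`. The corresponding primal iterate is `setBlock i (xb i) x`. -/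
noncomputable def nextY (P : Problem dX dY) (a : Params n m) (i : Fin n) (x xb : BlockSpace dX)
    (y yb : BlockSpace dY) : BlockSpace dY :=
  WithLp.toLp 2 fun j => if block P.A j i ≠ 0 then
    yb j + (a.σ j * theta P a j) • block P.A j i (xb i - x i) else y j

lemma A_setBlock_sub (P : Problem dX dY) (i : Fin n) (x : BlockSpace dX)
    (v : EuclideanSpace ℝ (Fin (dX i))) (j : Fin m) :
    P.A (setBlock i v x - x) j = block P.A j i (v - x i) := by
  rw [setBlock_eq_add_embed, add_sub_cancel_left]
  rfl

lemma sum_mul_sum_setBlock (ha : a.Admissible P)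
    (F : ∀ j, EuclideanSpace ℝ (Fin (dX j)) → ℝ) (x xb : BlockSpace dX) :
    ∑ i, a.p i * ∑ j, F j (setBlock i (xb i) x j) =
      ∑ j, F j (x j) + ∑ i, a.p i * (F i (xb i) - F i (x i)) := by
  simp only [sum_setBlock, mul_add, Finset.sum_add_distrib, ← Finset.sum_mul, ha.p_sum, one_mul]

lemma Problem.Standing.gSum_setBlock_ne_top (hP : P.Standing a.β) {x xb : BlockSpace dX}
    (hx : P.gSum x ≠ ⊤) (hxb : P.gSum xb ≠ ⊤) (i : Fin n) :
    P.gSum (setBlock i (xb i) x) ≠ ⊤ := by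
  rw [hP.gSum_ne_top_iff] at *
  intro j
  by_cases hj : j = i
  · subst hj
    rw [setBlock_same]
    exact hxb j
  · rw [setBlock_of_ne hj]
    exact hx j

lemma sum_mul_wNormSq_primal (ha : a.Admissible P) (x xb u : BlockSpace dX) :
    ∑ i, a.p i * wNormSq (fun i => (a.τ i)⁻¹ * (a.p i)⁻¹) (setBlock i (xb i) x - u) =
      wNormSq (fun i => (a.τ i)⁻¹ * (a.p i)⁻¹) (x - u)
        + (wNormSq a.τ⁻¹ (xb - u) - wNormSq a.τ⁻¹ (x - u)) := by
  have h := sum_mul_sum_setBlock ha (fun j v => (a.τ j)⁻¹ * (a.p j)⁻¹ * ‖v - u j‖ ^ 2) x xb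
  simp only [wNormSq, PiLp.sub_apply]
  rw [h, ← Finset.sum_sub_distrib]
  congr 1
  refine Finset.sum_congr rfl fun i _ => ?_
  have := (ha.p_pos i).ne'
  simp only [Pi.inv_apply]
  field_simp

/-- The averaged dual distance after one iteration. The choice `θ_j = π_j / p_min` gives the cross
terms of the extrapolation the weights `p_i`. -/
lemma sum_mul_wNormSq_dual_le (ha : a.Admissible P) (hrow : ∀ j, ∃ i, block P.A j i ≠ 0)
    (x xb : BlockSpace dX) (y yb v : BlockSpace dY) :
    ∑ i, a.p i * (pMin a / 2 *
        wNormSq (fun j => (a.σ j)⁻¹ * (piW P a j)⁻¹) (nextY P a i x xb y yb - v)) ≤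
      pMin a / 2 * wNormSq (fun j => (a.σ j)⁻¹ * (piW P a j)⁻¹) (y - v)
        + pMin a / 2 * (wNormSq a.σ⁻¹ (yb - v) - wNormSq a.σ⁻¹ (y - v))
        + ∑ i, a.p i * ⟪P.AT (yb - v) i, xb i - x i⟫
        + ∑ i, pMin a / 2 * (a.p i * ∑ j, (piW P a j)⁻¹ * a.σ j * theta P a j ^ 2
            * ‖block P.A j i‖ ^ 2) * ‖xb i - x i‖ ^ 2 := by
  classical
  have hp := ha.pMin_pos
  have hin : ∀ i, ⟪P.AT (yb - v) i, xb i - x i⟫ =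
      ∑ j, ⟪yb j - v j, block P.A j i (xb i - x i)⟫ := by
    intro i
    rw [← inner_embed_right, Problem.inner_AT, PiLp.inner_apply]
    rfl
  have hterm : ∀ i j, ‖nextY P a i x xb y yb j - v j‖ ^ 2 ≤
      (‖y j - v j‖ ^ 2 + (if block P.A j i ≠ 0 then 1 else 0) *
          (‖yb j - v j‖ ^ 2 - ‖y j - v j‖ ^ 2))
        + 2 * (a.σ j * theta P a j) * ⟪yb j - v j, block P.A j i (xb i - x i)⟫
        + (a.σ j * theta P a j) ^ 2 * (‖block P.A j i‖ ^ 2 * ‖xb i - x i‖ ^ 2) := by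
    intro i j
    by_cases hA : block P.A j i = 0
    · simp [nextY, hA]
    · have h1 : nextY P a i x xb y yb j - v j =
          (yb j - v j) + (a.σ j * theta P a j) • block P.A j i (xb i - x i) := by
        simp only [nextY, ne_eq, hA, not_false_eq_true, if_true]
        abel
      have h2 : ‖block P.A j i (xb i - x i)‖ ^ 2 ≤ ‖block P.A j i‖ ^ 2 * ‖xb i - x i‖ ^ 2 := by
        rw [← mul_pow]
        gcongr
        exact (block P.A j i).le_opNorm _
      rw [h1, norm_add_sq_real, norm_smul, real_inner_smul_right, mul_pow, Real.norm_eq_abs,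
        sq_abs]
      simp only [ne_eq, hA, not_false_eq_true, if_true]
      nlinarith [mul_le_mul_of_nonneg_left h2 (sq_nonneg (a.σ j * theta P a j))]
  have hpi : ∀ j, ∑ i, a.p i * (if block P.A j i ≠ 0 then (1 : ℝ) else 0) = piW P a j := by
    intro j
    simp only [piW, Finset.sum_filter, mul_ite, mul_one, mul_zero]
  calc ∑ i, a.p i * (pMin a / 2 *
        wNormSq (fun j => (a.σ j)⁻¹ * (piW P a j)⁻¹) (nextY P a i x xb y yb - v))
      ≤ ∑ i, a.p i * (pMin a / 2 * ∑ j, (a.σ j)⁻¹ * (piW P a j)⁻¹ *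
          ((‖y j - v j‖ ^ 2 + (if block P.A j i ≠ 0 then 1 else 0) *
              (‖yb j - v j‖ ^ 2 - ‖y j - v j‖ ^ 2))
            + 2 * (a.σ j * theta P a j) * ⟪yb j - v j, block P.A j i (xb i - x i)⟫
            + (a.σ j * theta P a j) ^ 2 * (‖block P.A j i‖ ^ 2 * ‖xb i - x i‖ ^ 2))) := by
        refine Finset.sum_le_sum fun i _ => ?_
        have := ha.p_pos i
        unfold wNormSq
        gcongr with j _
        · exact (mul_pos (inv_pos.2 (ha.σ_pos j)) (inv_pos.2 (ha.piW_pos hrow j))).le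
        · exact hterm i j
    _ = ∑ j, ∑ i, a.p i * (pMin a / 2 * ((a.σ j)⁻¹ * (piW P a j)⁻¹ *
          ((‖y j - v j‖ ^ 2 + (if block P.A j i ≠ 0 then 1 else 0) *
              (‖yb j - v j‖ ^ 2 - ‖y j - v j‖ ^ 2))
            + 2 * (a.σ j * theta P a j) * ⟪yb j - v j, block P.A j i (xb i - x i)⟫
            + (a.σ j * theta P a j) ^ 2 * (‖block P.A j i‖ ^ 2 * ‖xb i - x i‖ ^ 2)))) := by
        simp only [Finset.mul_sum]
        exact Finset.sum_comm
    _ = ∑ j, ((pMin a / 2 * ((a.σ j)⁻¹ * (piW P a j)⁻¹ * ‖y j - v j‖ ^ 2)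
          + pMin a / 2 * ((a.σ j)⁻¹ * ‖yb j - v j‖ ^ 2 - (a.σ j)⁻¹ * ‖y j - v j‖ ^ 2))
          + ∑ i, a.p i * ⟪yb j - v j, block P.A j i (xb i - x i)⟫
          + ∑ i, pMin a / 2 * (a.p i * ((piW P a j)⁻¹ * a.σ j * theta P a j ^ 2
            * ‖block P.A j i‖ ^ 2)) * ‖xb i - x i‖ ^ 2) := by
        refine Finset.sum_congr rfl fun j _ => ?_
        have hσ := (ha.σ_pos j).ne'
        have hπ := (ha.piW_pos hrow j).ne'
        have e1 : pMin a / 2 * ((a.σ j)⁻¹ * (piW P a j)⁻¹ * ‖y j - v j‖ ^ 2)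
            + pMin a / 2 * ((a.σ j)⁻¹ * ‖yb j - v j‖ ^ 2 - (a.σ j)⁻¹ * ‖y j - v j‖ ^ 2) =
            ∑ i, (a.p i * (pMin a / 2 * ((a.σ j)⁻¹ * (piW P a j)⁻¹ * ‖y j - v j‖ ^ 2))
              + a.p i * (if block P.A j i ≠ 0 then 1 else 0) * (pMin a / 2 *
                ((a.σ j)⁻¹ * (piW P a j)⁻¹ * (‖yb j - v j‖ ^ 2 - ‖y j - v j‖ ^ 2)))) := by
          rw [Finset.sum_add_distrib, ← Finset.sum_mul, ← Finset.sum_mul, ha.p_sum, hpi]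
          field_simp
        rw [e1, ← Finset.sum_add_distrib, ← Finset.sum_add_distrib]
        refine Finset.sum_congr rfl fun i _ => ?_
        rw [theta]
        field_simp
    _ = _ := by
        simp only [hin, wNormSq, Finset.sum_add_distrib, ← Finset.mul_sum, Finset.sum_sub_distrib,
          PiLp.sub_apply, Pi.inv_apply]
        congr 1
        · congr 1
          simp only [Finset.mul_sum]
          exact Finset.sum_comm
        · simp only [Finset.mul_sum, Finset.sum_mul]
          exact Finset.sum_comm

lemma sum_mul_Dp_le (hP : P.Standing a.β) (ha : a.Admissible P) {x xb : BlockSpace dX}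
    (hx : P.gSum x ≠ ⊤) (hxb : P.gSum xb ≠ ⊤) (u : PDSpace dX dY) :
    ∑ i, a.p i * P.Dp (setBlock i (xb i) x) u ≤ P.Dp x u
      + ∑ i, a.p i * (⟪gradient P.f x i, xb i - x i⟫ + ⟪P.AT u.snd i, xb i - x i⟫
        + ((P.g i (xb i)).toReal - (P.g i (x i)).toReal) + a.β i / 2 * ‖xb i - x i‖ ^ 2) := by
  have h1 : P.Dp x u = ∑ i, a.p i * P.Dp x u := by rw [← Finset.sum_mul, ha.p_sum, one_mul]
  rw [h1, ← Finset.sum_add_distrib]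
  refine Finset.sum_le_sum fun i _ => ?_
  rw [← mul_add]
  refine mul_le_mul_of_nonneg_left ?_ (ha.p_pos i).le
  have hf := hP.coord_lipschitz x i (xb i - x i)
  rw [← setBlock_eq_add_embed] at hf
  have hg := sum_setBlock (fun j v => (P.g j v).toReal) i (xb i) x
  have hl : ⟪P.AT u.snd, setBlock i (xb i) x - u.fst⟫ =
      ⟪P.AT u.snd, x - u.fst⟫ + ⟪P.AT u.snd i, xb i - x i⟫ := by
    rw [setBlock_eq_add_embed, add_sub_right_comm, inner_add_right, inner_embed_right]
  rw [Problem.Dp, Problem.Dp, hP.toReal_gSum (hP.gSum_setBlock_ne_top hx hxb i),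
    hP.toReal_gSum hx, hg, hl]
  linarith

/-- The optimality condition of the primal proximal step, with the gradient step separated. -/
lemma sub_mem_subdifferential_of_isProx (hP : P.Standing a.β) (ha : a.Admissible P)
    {x q xb : BlockSpace dX} (h : IsProx a.τ P.gSum (x - diagOp a.τ q) xb) :
    diagOp a.τ⁻¹ (x - xb) - q ∈ subdifferential P.gSum xb := by
  have h1 := h.mem_subdifferential hP.gSum_properConvexLsc
  have e : diagOp a.τ⁻¹ (x - diagOp a.τ q - xb) = diagOp a.τ⁻¹ (x - xb) - q := by
    ext i : 1
    simp [smul_smul, (ha.τ_pos i).ne']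
    abel
  rwa [e] at h1

lemma add_mem_subdifferential_of_isProx (hP : P.Standing a.β) (ha : a.Admissible P)
    {y q yb : BlockSpace dY} (h : IsProx a.σ (conjugate P.h) (y + diagOp a.σ q) yb) :
    diagOp a.σ⁻¹ (y - yb) + q ∈ subdifferential (conjugate P.h) yb := by
  have h1 := h.mem_subdifferential hP.conjugate_properConvexLsc
  have e : diagOp a.σ⁻¹ (y + diagOp a.σ q - yb) = diagOp a.σ⁻¹ (y - yb) + q := by
    ext i : 1
    simp [smul_smul, (ha.σ_pos i).ne']
    abel
  rwa [e] at h1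

lemma prox_block_le (hP : P.Standing a.β) (ha : a.Admissible P) {x q xb : BlockSpace dX}
    (hx : P.gSum x ≠ ⊤) (h : IsProx a.τ P.gSum (x - diagOp a.τ q) xb) (i : Fin n) :
    ⟪q i, xb i - x i⟫ + ((P.g i (xb i)).toReal - (P.g i (x i)).toReal) ≤
      -((a.τ i)⁻¹ * ‖xb i - x i‖ ^ 2) := by
  obtain ⟨hxb, h1⟩ := hP.gSum_properConvexLsc.mem_subdifferential_iff.1
    (sub_mem_subdifferential_of_isProx hP ha h)
  have hs := hP.gSum_setBlock_ne_top hxb hx i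
  have h2 := h1 _ hs
  rw [hP.toReal_gSum hs, hP.toReal_gSum hxb, sum_setBlock (fun j v => (P.g j v).toReal),
    setBlock_eq_add_embed, add_sub_cancel_left, inner_embed_right, PiLp.sub_apply, diagOp_apply,
    PiLp.sub_apply, inner_sub_left, real_inner_smul_left, real_inner_self_eq_norm_sq,
    norm_sub_rev, ← neg_sub (xb i) (x i), inner_neg_right] at h2
  simp only [Pi.inv_apply] at h2
  linarith

lemma prox_primal_le (hP : P.Standing a.β) (ha : a.Admissible P) {x xb : BlockSpace dX}
    {yb : BlockSpace dY} (hx : P.gSum x ≠ ⊤)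
    (h : IsProx a.τ P.gSum (x - diagOp a.τ (gradient P.f x + P.AT yb)) xb)
    {u : PDSpace dX dY} (hu : P.gSum u.fst ≠ ⊤) :
    ∑ i, (⟪(gradient P.f x + P.AT yb) i, xb i - x i⟫
        + ((P.g i (xb i)).toReal - (P.g i (x i)).toReal)) ≤
      -P.Dp x u + ⟪yb - u.snd, P.A (u.fst - x)⟫
        + 1 / 2 * (wNormSq a.τ⁻¹ (x - u.fst) - wNormSq a.τ⁻¹ (xb - u.fst)
          - wNormSq a.τ⁻¹ (xb - x)) := by
  obtain ⟨hxb, h1⟩ := hP.gSum_properConvexLsc.mem_subdifferential_iff.1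
    (sub_mem_subdifferential_of_isProx hP ha h)
  have h2 := h1 _ hu
  have h3 := two_mul_inner_diagOp_sub a.τ⁻¹ x xb u.fst
  have h4 := add_inner_gradient_le hP.f_convex hP.f_diff x u.fst
  have h5 : wNormSq a.τ⁻¹ (x - xb) = wNormSq a.τ⁻¹ (xb - x) := by rw [← wNormSq_neg, neg_sub]
  have h6 : ∑ i, ⟪(gradient P.f x + P.AT yb) i, xb i - x i⟫ =
      ⟪gradient P.f x + P.AT yb, xb - x⟫ := by
    rw [PiLp.inner_apply]
    rfl
  rw [Finset.sum_add_distrib, Finset.sum_sub_distrib, h6, ← hP.toReal_gSum hx,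
    ← hP.toReal_gSum hxb, Problem.Dp]
  simp only [inner_sub_left, inner_sub_right, inner_add_left, Problem.inner_AT, map_sub] at *
  linarith

lemma prox_dual_le (hP : P.Standing a.β) (ha : a.Admissible P) {x : BlockSpace dX}
    {y yb : BlockSpace dY} (h : IsProx a.σ (conjugate P.h) (y + diagOp a.σ (P.A x)) yb)
    {u : PDSpace dX dY} (hu : u ∈ P.solutions) :
    1 / 2 * (wNormSq a.σ⁻¹ (yb - u.snd) - wNormSq a.σ⁻¹ (y - u.snd)) ≤
      -(1 / 2 * wNormSq a.σ⁻¹ (yb - y)) + ⟪yb - u.snd, P.A (x - u.fst)⟫ := by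
  obtain ⟨hyb, h1⟩ := hP.conjugate_properConvexLsc.mem_subdifferential_iff.1
    (add_mem_subdifferential_of_isProx hP ha h)
  have h2 := h1 _ (Problem.mem_solutions_iff.1 hu).2.1
  have h3 := two_mul_inner_diagOp_sub a.σ⁻¹ y yb u.snd
  have h4 := hP.solution_dual_le hu hyb
  have h5 : wNormSq a.σ⁻¹ (y - yb) = wNormSq a.σ⁻¹ (yb - y) := by rw [← wNormSq_neg, neg_sub]
  rw [inner_add_left] at h2
  rw [real_inner_comm]
  simp only [inner_sub_left, inner_sub_right, map_sub] at *
  linarith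

/-- The descent inequality: the average over the sampled index of `D_p(·; u) + V(· - u)` at the next
iterate. -/
lemma sum_mul_lyapunov_le [NeZero m] (hP : P.Standing a.β) (ha : a.Admissible P)
    (hrow : ∀ j, ∃ i, block P.A j i ≠ 0) {x xb : BlockSpace dX} {y yb : BlockSpace dY}
    (hx : P.gSum x ≠ ⊤) (hyb : IsProx a.σ (conjugate P.h) (y + diagOp a.σ (P.A x)) yb)
    (hxb : IsProx a.τ P.gSum (x - diagOp a.τ (gradient P.f x + P.AT yb)) xb)
    {u : PDSpace dX dY} (hu : u ∈ P.solutions) :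
    ∑ i, a.p i * (P.Dp (setBlock i (xb i) x) u
        + V P a (pair (setBlock i (xb i) x) (nextY P a i x xb y yb) - u)) ≤
      (1 - pMin a) * P.Dp x u + V P a (pair x y - u)
        - C2Vt P a * ‖pair xb yb - pair x y‖ ^ 2 := by
  have hp := ha.pMin_pos
  have hu1 := (Problem.mem_solutions_iff.1 hu).1.1
  have hxb1 := (sub_mem_subdifferential_of_isProx hP ha hxb).1
  set G : Fin n → ℝ := fun i => ⟪(gradient P.f x + P.AT yb) i, xb i - x i⟫
        + ((P.g i (xb i)).toReal - (P.g i (x i)).toReal) with hG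
  have h1 := sum_mul_Dp_le hP ha hx hxb1 u
  have h2 := sum_mul_wNormSq_primal ha x xb u.fst
  have h3 := sum_mul_wNormSq_dual_le ha hrow x xb y yb u.snd
  have h4 := prox_primal_le hP ha hx hxb hu1
  have h5 := prox_dual_le hP ha hyb hu
  -- the part `pMin` of the weight `p i` is spent on comparing with `u`, the rest with `x`
  have h6 : ∑ i, a.p i * G i ≤
      pMin a * ∑ i, G i - ∑ i, (a.p i - pMin a) * ((a.τ i)⁻¹ * ‖xb i - x i‖ ^ 2) := by
    rw [Finset.mul_sum, ← Finset.sum_sub_distrib]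
    refine Finset.sum_le_sum fun i _ => ?_
    have hb := mul_le_mul_of_nonneg_left (prox_block_le hP ha hx hxb i)
      (sub_nonneg.2 (pMin_le a i))
    change (a.p i - pMin a) * G i ≤ _ at hb
    linarith
  have h7 : C2Vt P a * ‖pair xb yb - pair x y‖ ^ 2 ≤
      ∑ i, pMin a / 2 * Ctau P a i * ‖xb i - x i‖ ^ 2 + pMin a / 2 * wNormSq a.σ⁻¹ (yb - y) := by
    rw [WithLp.prod_norm_sq_eq_of_L2, mul_add]
    refine add_le_add ?_ ?_
    · exact mul_norm_sq_le_wNormSq (w := fun i => pMin a / 2 * Ctau P a i)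
        (fun i => C2Vt_le_Ctau ha i) (xb - x)
    · have := mul_norm_sq_le_wNormSq (w := fun j => pMin a / 2 * (a.σ j)⁻¹)
        (fun j => C2Vt_le_inv_σ ha j) (yb - y)
      rw [wNormSq, Finset.mul_sum]
      simp only [wNormSq, mul_assoc] at this
      exact this
  have h8 : ∑ i, a.p i * (⟪gradient P.f x i, xb i - x i⟫ + ⟪P.AT u.snd i, xb i - x i⟫
        + ((P.g i (xb i)).toReal - (P.g i (x i)).toReal) + a.β i / 2 * ‖xb i - x i‖ ^ 2)
      + ∑ i, a.p i * ⟪P.AT (yb - u.snd) i, xb i - x i⟫ =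
      ∑ i, a.p i * G i + ∑ i, a.p i * (a.β i / 2 * ‖xb i - x i‖ ^ 2) := by
    rw [← Finset.sum_add_distrib, ← Finset.sum_add_distrib]
    refine Finset.sum_congr rfl fun i _ => ?_
    simp only [hG, map_sub, PiLp.sub_apply, PiLp.add_apply, inner_add_left,
      inner_sub_left (𝕜 := ℝ) (P.AT yb i)]
    ring
  have h9 : ∑ i, pMin a / 2 * Ctau P a i * ‖xb i - x i‖ ^ 2 =
      ∑ i, (a.p i - pMin a) * ((a.τ i)⁻¹ * ‖xb i - x i‖ ^ 2)
      + pMin a / 2 * wNormSq a.τ⁻¹ (xb - x)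
      - ∑ i, a.p i * (a.β i / 2 * ‖xb i - x i‖ ^ 2)
      - ∑ i, pMin a / 2 * (a.p i * ∑ j, (piW P a j)⁻¹ * a.σ j * theta P a j ^ 2
            * ‖block P.A j i‖ ^ 2) * ‖xb i - x i‖ ^ 2 := by
    rw [wNormSq, Finset.mul_sum, ← Finset.sum_add_distrib, ← Finset.sum_sub_distrib,
      ← Finset.sum_sub_distrib]
    refine Finset.sum_congr rfl fun i _ => ?_
    have := (ha.τ_pos i).ne'
    rw [Ctau]
    simp only [Pi.inv_apply, PiLp.sub_apply]
    field_simp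
    ring
  have h10 : ∑ i, a.p i * (P.Dp (setBlock i (xb i) x) u
        + V P a (pair (setBlock i (xb i) x) (nextY P a i x xb y yb) - u)) =
      ∑ i, a.p i * P.Dp (setBlock i (xb i) x) u
        + pMin a / 2 * ∑ i, a.p i * wNormSq (fun i => (a.τ i)⁻¹ * (a.p i)⁻¹)
            (setBlock i (xb i) x - u.fst)
        + ∑ i, a.p i * (pMin a / 2 * wNormSq (fun j => (a.σ j)⁻¹ * (piW P a j)⁻¹)
            (nextY P a i x xb y yb - u.snd)) := by
    rw [Finset.mul_sum, ← Finset.sum_add_distrib, ← Finset.sum_add_distrib]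
    refine Finset.sum_congr rfl fun i _ => ?_
    simp only [V, WithLp.sub_fst, WithLp.sub_snd, pair_fst, pair_snd]
    ring
  have h11 : ⟪yb - u.snd, P.A (u.fst - x)⟫ = -⟪yb - u.snd, P.A (x - u.fst)⟫ := by
    rw [← inner_neg_right, ← map_neg, neg_sub]
  rw [h10, h2]
  have h4' := mul_le_mul_of_nonneg_left h4 hp.le
  have h5' := mul_le_mul_of_nonneg_left h5 hp.le
  rw [h11] at h4'
  rw [V]
  simp only [WithLp.sub_fst, WithLp.sub_snd, pair_fst, pair_snd]
  linarith

/-! ### The contribution of metric subregularity -/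

/-- The residual of the full proximal points in the optimality conditions. -/
lemma exists_mem_kkt_norm_le (hP : P.Standing a.β) (ha : a.Admissible P)
    {βbar : NNReal} (hβ : LipschitzWith βbar (gradient P.f)) {x xb : BlockSpace dX}
    {y yb : BlockSpace dY} (hyb : IsProx a.σ (conjugate P.h) (y + diagOp a.σ (P.A x)) yb)
    (hxb : IsProx a.τ P.gSum (x - diagOp a.τ (gradient P.f x + P.AT yb)) xb) :
    ∃ w ∈ P.kkt (pair xb yb), ‖w‖ ≤ (‖H P a - M P‖ + βbar) * ‖pair xb yb - pair x y‖ := by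
  refine ⟨_, ⟨_, sub_mem_subdifferential_of_isProx hP ha hxb, _,
    add_mem_subdifferential_of_isProx hP ha hyb, rfl⟩, ?_⟩
  set b : PDSpace dX dY := pair (diagOp a.τ⁻¹ (x - xb)) (-(P.A (x - xb) + diagOp a.σ⁻¹ (y - yb)))
    with hb
  set e : PDSpace dX dY := pair (gradient P.f xb - gradient P.f x) 0 with he
  have h1 : pair (gradient P.f xb
      + (diagOp a.τ⁻¹ (x - xb) - (gradient P.f x + P.AT yb)) + P.AT yb)
      (P.A xb - (diagOp a.σ⁻¹ (y - yb) + P.A x)) = b + e := by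
    rw [hb, he, pair_add_pair]
    congr 1
    · abel
    · rw [map_sub P.A]
      abel
  -- up to the sign of the dual component, `b` is the image of `(x, y) - (xb, yb)` under `H - M`
  have h2 : ‖b‖ ≤ ‖H P a - M P‖ * ‖pair xb yb - pair x y‖ := by
    have h3 : ‖b‖ = ‖(H P a - M P) (pair x y - pair xb yb)‖ := by
      have h4 : (H P a - M P) (pair x y - pair xb yb) =
          pair (diagOp a.τ⁻¹ (x - xb)) (P.A (x - xb) + diagOp a.σ⁻¹ (y - yb)) := by
        have h5 : H P a (pair x y - pair xb yb) =
            pair (diagOp a.τ⁻¹ (x - xb) + P.AT (y - yb)) (0 + diagOp a.σ⁻¹ (y - yb)) := rfl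
        have h6 : M P (pair x y - pair xb yb) =
            pair (0 + P.AT (y - yb)) (-P.A (x - xb) + 0) := rfl
        rw [sub_apply, h5, h6, pair_sub_pair]
        congr 1 <;> abel
      rw [h4, ← sq_eq_sq₀ (norm_nonneg _) (norm_nonneg _), WithLp.prod_norm_sq_eq_of_L2,
        WithLp.prod_norm_sq_eq_of_L2, hb]
      simp only [pair_fst, pair_snd, norm_neg]
    rw [h3, norm_sub_rev (pair xb yb)]
    exact ContinuousLinearMap.le_opNorm _ _
  have h3 : ‖e‖ ≤ βbar * ‖pair xb yb - pair x y‖ := by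
    have h4 : ‖e‖ = ‖gradient P.f xb - gradient P.f x‖ := by
      rw [← sq_eq_sq₀ (norm_nonneg _) (norm_nonneg _), WithLp.prod_norm_sq_eq_of_L2, he]
      simp only [pair_fst, pair_snd, norm_zero]
      ring
    have h5 : ‖xb - x‖ ≤ ‖pair xb yb - pair x y‖ := by
      refine (abs_le_of_sq_le_sq' ?_ (norm_nonneg _)).2
      rw [WithLp.prod_norm_sq_eq_of_L2]
      exact le_add_of_nonneg_right (sq_nonneg _)
    rw [h4]
    exact (hβ.norm_sub_le xb x).trans (by gcongr)
  simp only [pair_fst, pair_snd]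
  rw [h1, add_mul]
  exact (norm_add_le _ _).trans (add_le_add h2 h3)

/-- The distance to the solution set is controlled by the length of a full step. -/
lemma infDist_solutions_le (hP : P.Standing a.β) (ha : a.Admissible P)
    {βbar : NNReal} (hβ : LipschitzWith βbar (gradient P.f)) {x xb : BlockSpace dX}
    {y yb : BlockSpace dY} (hyb : IsProx a.σ (conjugate P.h) (y + diagOp a.σ (P.A x)) yb)
    (hxb : IsProx a.τ P.gSum (x - diagOp a.τ (gradient P.f x + P.AT yb)) xb)
    {u : PDSpace dX dY} {η : ℝ} {N : Set (PDSpace dX dY)}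
    (hsub : MetricallySubregularAt P.kkt u 0 η N) (hN : pair xb yb ∈ N) :
    Metric.infDist (pair x y) P.solutions ≤
      (1 + η * (‖H P a - M P‖ + βbar)) * ‖pair xb yb - pair x y‖ := by
  obtain ⟨w, hw, hwn⟩ := exists_mem_kkt_norm_le hP ha hβ hyb hxb
  have h1 : Metric.infDist (pair xb yb) P.solutions ≤ η * ‖w‖ := by
    have h2 : Metric.infEDist (pair xb yb) P.solutions ≤ ENNReal.ofReal (η * ‖w‖) := by
      rw [ENNReal.ofReal_mul hsub.pos.le]
      refine (hsub.bound _ hN).trans ?_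
      gcongr
      refine (Metric.infEDist_le_edist_of_mem hw).trans ?_
      rw [edist_dist, dist_zero_left]
    exact ENNReal.toReal_le_of_le_ofReal (mul_nonneg hsub.pos.le (norm_nonneg _)) h2
  have h3 : Metric.infDist (pair x y) P.solutions ≤
      Metric.infDist (pair xb yb) P.solutions + dist (pair x y) (pair xb yb) :=
    Metric.infDist_le_infDist_add_dist
  rw [dist_eq_norm, norm_sub_rev] at h3
  have h4 := mul_le_mul_of_nonneg_left hwn hsub.pos.le
  linarith

/-- Metric subregularity bounds the weighted distance to the Bregman-type projection by the length
of a full step; the factor makes the full-step term of the descent inequality dominate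
`rate * V`. -/
lemma rate_mul_V_le [NeZero m] (hP : P.Standing a.β) (ha : a.Admissible P)
    (hrow : ∀ j, ∃ i, block P.A j i ≠ 0)
    {βbar : NNReal} (hβ : LipschitzWith βbar (gradient P.f)) {x xb : BlockSpace dX}
    {y yb : BlockSpace dY} (hyb : IsProx a.σ (conjugate P.h) (y + diagOp a.σ (P.A x)) yb)
    (hxb : IsProx a.τ P.gSum (x - diagOp a.τ (gradient P.f x + P.AT yb)) xb)
    {u : PDSpace dX dY} {η : ℝ} {N : Set (PDSpace dX dY)}
    (hsub : MetricallySubregularAt P.kkt u 0 η N) (hN : pair xb yb ∈ N)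
    {v : PDSpace dX dY} (hv : IsBregmanProj P a x y v) :
    rate P a βbar η * V P a (pair x y - v) ≤ C2Vt P a * ‖pair xb yb - pair x y‖ ^ 2 := by
  have hd := infDist_solutions_le hP ha hβ hyb hxb hsub hN
  have hC := ha.CV2_pos
  have hc := cConst_nonneg P a
  have hη := hsub.pos
  set L := η * (‖H P a - M P‖ + βbar) with hL
  have hL0 : 0 ≤ L := by positivity
  obtain ⟨e, he, hed⟩ := (hP.isClosed_solutions hβ).exists_infDist_eq_dist hP.solutions_nonempty
    (pair x y)
  rw [hed, dist_eq_norm] at hd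
  set K := (2 + 2 * cConst P a) + (1 + cConst P a) * L with hK
  have hK0 : 0 < K := by positivity
  have h1 : V P a (pair x y - v) ≤ CV2 a * K ^ 2 * ‖pair xb yb - pair x y‖ ^ 2 := by
    calc V P a (pair x y - v) ≤ (1 + cConst P a) ^ 2 * V P a (pair x y - e) :=
          hv.V_sub_le hP ha hrow hβ he
      _ ≤ (1 + cConst P a) ^ 2 * (CV2 a * ‖pair x y - e‖ ^ 2) := by
          gcongr
          exact ha.V_le hrow _
      _ ≤ (1 + cConst P a) ^ 2 * (CV2 a * ((1 + L) * ‖pair xb yb - pair x y‖) ^ 2) := by gcongr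
      _ = CV2 a * ((1 + cConst P a) * (1 + L)) ^ 2 * ‖pair xb yb - pair x y‖ ^ 2 := by ring
      _ ≤ _ := by
          -- `(1 + c) (1 + L) ≤ (1 + c) (2 + L) = K`
          gcongr
          rw [hK]
          nlinarith
  have h2 : 0 ≤ V P a (pair x y - v) := ha.V_nonneg hrow _
  have h3 := ha.C2Vt_pos hrow
  calc rate P a βbar η * V P a (pair x y - v)
      ≤ C2Vt P a / (CV2 a * K ^ 2) * V P a (pair x y - v) := by
        gcongr
        exact min_le_right _ _
    _ ≤ C2Vt P a / (CV2 a * K ^ 2) * (CV2 a * K ^ 2 * ‖pair xb yb - pair x y‖ ^ 2) := by gcongr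
    _ = _ := by field_simp

end OneStep

/-! ### Functions of finitely many independent indices -/

section Sampling

variable {n : ℕ} {Ω : Type*} {idx : ℕ → Ω → Fin n}

/-- The random variable `X` is a function of the indices drawn before iteration `k`. -/
def DependsOnPast {β : Type*} (idx : ℕ → Ω → Fin n) (k : ℕ) (X : Ω → β) : Prop :=
  ∀ ω ω', (∀ j < k, idx j ω = idx j ω') → X ω = X ω'

lemma DependsOnPast.exists_eq_comp {k : ℕ} {X : Ω → ℝ} (hX : DependsOnPast idx k X) :
    ∃ F : (Finset.range k → Fin n) → ℝ, X = F ∘ fun ω (j : Finset.range k) => idx j ω := by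
  refine (Function.factorsThrough_iff X).1 fun ω ω' h => hX ω ω' fun j hj => ?_
  exact congrFun h ⟨j, Finset.mem_range.2 hj⟩

variable [MeasurableSpace Ω] {μ : Measure Ω} [IsProbabilityMeasure μ]

lemma DependsOnPast.integrable (hmeas : ∀ k, Measurable (idx k)) {k : ℕ} {X : Ω → ℝ}
    (hX : DependsOnPast idx k X) : Integrable X μ := by
  obtain ⟨F, rfl⟩ := hX.exists_eq_comp
  have hm : Measurable fun ω (j : Finset.range k) => idx j ω :=
    measurable_pi_lambda _ fun j => hmeas j
  have := Measure.isProbabilityMeasure_map (μ := μ) hm.aemeasurable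
  exact (Integrable.of_finite (μ := μ.map _)).comp_measurable hm

/-- Averaging over the index drawn at iteration `k`, which is independent of the past. -/
lemma integrable_and_integral_apply_idx {p : Fin n → ℝ} (hmeas : ∀ k, Measurable (idx k))
    (hindep : iIndepFun idx μ) (hlaw : ∀ k i, μ.real {ω | idx k ω = i} = p i) {k : ℕ}
    {X : Fin n → Ω → ℝ} (hX : ∀ i, DependsOnPast idx k (X i)) :
    Integrable (fun ω => X (idx k ω) ω) μ ∧
      ∫ ω, X (idx k ω) ω ∂μ = ∫ ω, ∑ i, p i * X i ω ∂μ := by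
  have hind : ∀ i, IndepFun (fun ω => ({i} : Set (Fin n)).indicator (1 : Fin n → ℝ) (idx k ω))
      (X i) μ := by
    intro i
    obtain ⟨F, hF⟩ := (hX i).exists_eq_comp
    have h := hindep.indepFun_finset {k} (Finset.range k) (by simp) hmeas
    rw [hF]
    exact h.comp
      (φ := fun v => ({i} : Set (Fin n)).indicator (1 : Fin n → ℝ)
        (v ⟨k, Finset.mem_singleton_self k⟩))
      (ψ := F) (Measurable.of_discrete) (Measurable.of_discrete)
  have hone : ∀ i, Measurable fun ω => ({i} : Set (Fin n)).indicator (1 : Fin n → ℝ) (idx k ω) :=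
    fun i => (Measurable.of_discrete (f := ({i} : Set (Fin n)).indicator (1 : Fin n → ℝ))).comp
      (hmeas k)
  have hsplit : (fun ω => X (idx k ω) ω) =
      fun ω => ∑ i, ({i} : Set (Fin n)).indicator (1 : Fin n → ℝ) (idx k ω) * X i ω := by
    funext ω
    rw [Finset.sum_eq_single (idx k ω)]
    · simp
    · intro i _ hi
      simp [hi.symm]
    · simp
  have hint : ∀ i, Integrable
      (fun ω => ({i} : Set (Fin n)).indicator (1 : Fin n → ℝ) (idx k ω) * X i ω) μ := by
    intro i
    refine ((hX i).integrable hmeas).bdd_mul (c := 1) (hone i).aestronglyMeasurable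
      (Filter.Eventually.of_forall fun ω => ?_)
    by_cases h : idx k ω = i <;> simp [h]
  rw [hsplit]
  refine ⟨integrable_finsetSum _ fun i _ => hint i, ?_⟩
  rw [integral_finsetSum _ fun i _ => hint i,
    integral_finsetSum _ fun i _ => ((hX i).integrable hmeas).const_mul _]
  refine Finset.sum_congr rfl fun i _ => ?_
  rw [(hind i).integral_fun_mul_eq_mul_integral (hone i).aestronglyMeasurable
    ((hX i).integrable hmeas).aestronglyMeasurable, integral_const_mul, ← hlaw k i]
  congr 1
  have hs : MeasurableSet {ω | idx k ω = i} := hmeas k (measurableSet_singleton i)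
  rw [← integral_indicator_one hs]
  refine integral_congr_ae (Filter.Eventually.of_forall fun ω => ?_)
  by_cases h : idx k ω = i <;> simp [h]

end Sampling

/-! ### The random iterates -/

section Iterates

variable {n m : ℕ} {dX : Fin n → ℕ} {dY : Fin m → ℕ} {P : Problem dX dY} {a : Params n m}
  {Ω : Type*} {idx : ℕ → Ω → Fin n} {x0 : BlockSpace dX} {y0 : BlockSpace dY}
  {x xbar : ℕ → Ω → BlockSpace dX} {y ybar : ℕ → Ω → BlockSpace dY}

lemma IsPureCD.x_succ (hrun : IsPureCD P a idx x0 y0 x xbar y ybar) (k : ℕ) (ω : Ω) :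
    x (k + 1) ω = setBlock (idx k ω) (xbar (k + 1) ω (idx k ω)) (x k ω) := by
  ext i : 1
  rw [hrun.x_step]
  by_cases h : i = idx k ω
  · subst h
    rw [if_pos rfl, setBlock_same]
  · rw [if_neg h, setBlock_of_ne h]

lemma IsPureCD.y_succ (hrun : IsPureCD P a idx x0 y0 x xbar y ybar) (k : ℕ) (ω : Ω) :
    y (k + 1) ω = nextY P a (idx k ω) (x k ω) (xbar (k + 1) ω) (y k ω) (ybar (k + 1) ω) := by
  ext j : 1
  rw [hrun.y_step, hrun.x_succ, A_setBlock_sub]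
  rfl

lemma IsPureCD.gSum_ne_top (hrun : IsPureCD P a idx x0 y0 x xbar y ybar) (hP : P.Standing a.β)
    (ha : a.Admissible P) (hx0 : P.gSum x0 ≠ ⊤) (k : ℕ) (ω : Ω) : P.gSum (x k ω) ≠ ⊤ := by
  induction k with
  | zero => rwa [hrun.init_x]
  | succ k ih =>
    rw [hrun.x_succ]
    exact hP.gSum_setBlock_ne_top ih
      (sub_mem_subdifferential_of_isProx hP ha (hrun.xbar_step k ω)).1 _

/-- The full proximal points are determined by the current iterate. -/
lemma IsPureCD.bar_eq (hrun : IsPureCD P a idx x0 y0 x xbar y ybar) (hP : P.Standing a.β)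
    (ha : a.Admissible P) {k : ℕ} {ω ω' : Ω} (hx : x k ω = x k ω') (hy : y k ω = y k ω') :
    xbar (k + 1) ω = xbar (k + 1) ω' ∧ ybar (k + 1) ω = ybar (k + 1) ω' := by
  have h1 : ybar (k + 1) ω = ybar (k + 1) ω' := by
    refine (hrun.ybar_step k ω).unique ha.σ_pos hP.conjugate_properConvexLsc ?_
    rw [hx, hy]
    exact hrun.ybar_step k ω'
  refine ⟨(hrun.xbar_step k ω).unique ha.τ_pos hP.gSum_properConvexLsc ?_, h1⟩
  rw [hx, h1]
  exact hrun.xbar_step k ω'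

lemma IsPureCD.dependsOnPast (hrun : IsPureCD P a idx x0 y0 x xbar y ybar) (hP : P.Standing a.β)
    (ha : a.Admissible P) (k : ℕ) : DependsOnPast idx k fun ω => (x k ω, y k ω) := by
  induction k with
  | zero =>
    intro ω ω' _
    dsimp only
    rw [hrun.init_x, hrun.init_x, hrun.init_y, hrun.init_y]
  | succ k ih =>
    intro ω ω' h
    obtain ⟨hx, hy⟩ := Prod.ext_iff.1 (ih ω ω' fun j hj => h j (hj.trans k.lt_succ_self))
    obtain ⟨hxb, hyb⟩ := hrun.bar_eq hP ha hx hy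
    dsimp only at hx hy ⊢
    rw [hrun.x_succ, hrun.x_succ, hrun.y_succ, hrun.y_succ, hx, hy, hxb, hyb,
      h k k.lt_succ_self]

lemma IsPureCD.proj_eq [NeZero m] (hrun : IsPureCD P a idx x0 y0 x xbar y ybar)
    (hP : P.Standing a.β) (ha : a.Admissible P) (hrow : ∀ j, ∃ i, block P.A j i ≠ 0)
    {βbar : NNReal} (hβ : LipschitzWith βbar (gradient P.f)) {zs : ℕ → Ω → PDSpace dX dY}
    (hzs : ∀ k ω, IsBregmanProj P a (x k ω) (y k ω) (zs k ω)) {k : ℕ} {ω ω' : Ω}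
    (h : ∀ j < k, idx j ω = idx j ω') :
    x k ω = x k ω' ∧ y k ω = y k ω' ∧ zs k ω = zs k ω' := by
  obtain ⟨hx, hy⟩ := Prod.ext_iff.1 (hrun.dependsOnPast hP ha k ω ω' h)
  simp only at hx hy
  refine ⟨hx, hy, (hzs k ω).unique hP ha hrow hβ ?_⟩
  rw [hx, hy]
  exact hzs k ω'

lemma IsPureCD.dependsOnPast_proj [NeZero m] (hrun : IsPureCD P a idx x0 y0 x xbar y ybar)
    (hP : P.Standing a.β) (ha : a.Admissible P) (hrow : ∀ j, ∃ i, block P.A j i ≠ 0)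
    {βbar : NNReal} (hβ : LipschitzWith βbar (gradient P.f)) {zs : ℕ → Ω → PDSpace dX dY}
    (hzs : ∀ k ω, IsBregmanProj P a (x k ω) (y k ω) (zs k ω)) (k : ℕ)
    (F : BlockSpace dX → BlockSpace dY → PDSpace dX dY → ℝ) :
    DependsOnPast idx k fun ω => F (x k ω) (y k ω) (zs k ω) := by
  intro ω ω' h
  obtain ⟨hx, hy, hz⟩ := hrun.proj_eq hP ha hrow hβ hzs h
  simp only [hx, hy, hz]

variable [MeasurableSpace Ω] {μ : Measure Ω} [IsProbabilityMeasure μ]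

/-- Linear decrease of the expected Lyapunov function `D_p(x_k; z_k^⋆) + V(z_k - z_k^⋆)`. -/
lemma IsPureCD.integral_lyapunov_le [NeZero m] (hrun : IsPureCD P a idx x0 y0 x xbar y ybar)
    (hP : P.Standing a.β) (ha : a.Admissible P) (hrow : ∀ j, ∃ i, block P.A j i ≠ 0)
    {βbar : NNReal} (hβ : LipschitzWith βbar (gradient P.f))
    (hmeas : ∀ k, Measurable (idx k)) (hindep : iIndepFun idx μ)
    (hlaw : ∀ k i, μ.real {ω | idx k ω = i} = a.p i) (hx0 : P.gSum x0 ≠ ⊤)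
    {u : PDSpace dX dY} {η : ℝ} {N : Set (PDSpace dX dY)}
    (hsub : MetricallySubregularAt P.kkt u 0 η N)
    (hN : ∀ᵐ ω ∂μ, ∀ k, pair (xbar (k + 1) ω) (ybar (k + 1) ω) ∈ N)
    {zs : ℕ → Ω → PDSpace dX dY} (hzs : ∀ k ω, IsBregmanProj P a (x k ω) (y k ω) (zs k ω)) (k : ℕ) :
    ∫ ω, (P.Dp (x (k + 1) ω) (zs (k + 1) ω)
        + V P a (pair (x (k + 1) ω) (y (k + 1) ω) - zs (k + 1) ω)) ∂μ ≤
      (1 - rate P a βbar η) *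
        ∫ ω, (P.Dp (x k ω) (zs k ω) + V P a (pair (x k ω) (y k ω) - zs k ω)) ∂μ := by
  have hdep := hrun.dependsOnPast_proj hP ha hrow hβ hzs
  -- the value at the next iterate, relative to the current projection, if the index `i` is drawn
  set X : Fin n → Ω → ℝ := fun i ω =>
    P.Dp (setBlock i (xbar (k + 1) ω i) (x k ω)) (zs k ω)
      + V P a (pair (setBlock i (xbar (k + 1) ω i) (x k ω))
        (nextY P a i (x k ω) (xbar (k + 1) ω) (y k ω) (ybar (k + 1) ω)) - zs k ω) with hXdef
  have hX : ∀ i, DependsOnPast idx k (X i) := by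
    intro i ω ω' h
    obtain ⟨hx, hy, hz⟩ := hrun.proj_eq hP ha hrow hβ hzs h
    obtain ⟨hxb, hyb⟩ := hrun.bar_eq hP ha hx hy
    simp only [hXdef, hx, hy, hz, hxb, hyb]
  obtain ⟨hXint, hXeq⟩ := integrable_and_integral_apply_idx hmeas hindep hlaw hX
  calc ∫ ω, (P.Dp (x (k + 1) ω) (zs (k + 1) ω)
        + V P a (pair (x (k + 1) ω) (y (k + 1) ω) - zs (k + 1) ω)) ∂μ
      ≤ ∫ ω, X (idx k ω) ω ∂μ := by
        refine integral_mono ((hdep (k + 1) fun x y z => P.Dp x z + V P a (pair x y - z)).integrable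
          hmeas) hXint fun ω => ?_
        have h := (hzs (k + 1) ω).2 (zs k ω) (hzs k ω).1
        rw [hrun.x_succ, hrun.y_succ] at h ⊢
        exact h
    _ = ∫ ω, ∑ i, a.p i * X i ω ∂μ := hXeq
    _ ≤ ∫ ω, (1 - rate P a βbar η) *
          (P.Dp (x k ω) (zs k ω) + V P a (pair (x k ω) (y k ω) - zs k ω)) ∂μ := by
        refine integral_mono_ae
          (integrable_finsetSum _ fun i _ => ((hX i).integrable hmeas).const_mul _)
          (((hdep k fun x y z => P.Dp x z + V P a (pair x y - z)).integrable hmeas).const_mul _) ?_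
        filter_upwards [hN] with ω hω
        have hx := hrun.gSum_ne_top hP ha hx0 k ω
        have h1 := sum_mul_lyapunov_le hP ha hrow hx (hrun.ybar_step k ω) (hrun.xbar_step k ω)
          (hzs k ω).1
        have h2 := rate_mul_V_le hP ha hrow hβ (hrun.ybar_step k ω) (hrun.xbar_step k ω) hsub
          (hω k) (hzs k ω)
        have h3 := hP.Dp_nonneg hx (hzs k ω).1
        have h4 : rate P a βbar η * P.Dp (x k ω) (zs k ω) ≤ pMin a * P.Dp (x k ω) (zs k ω) :=
          mul_le_mul_of_nonneg_right (min_le_left _ _) h3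
        simp only [hXdef]
        linarith
    _ = _ := integral_const_mul _ _

end Iterates

end PureCD

theorem theorem2 {n m : ℕ} [NeZero m] {dX : Fin n → ℕ} {dY : Fin m → ℕ}
    (P : PureCD.Problem dX dY) (a : PureCD.Params n m)
    (hP : P.Standing a.β) (ha : a.Admissible P)
    -- every block row of `A` is nonzero, so that all `π_j` are positive
    (hrow : ∀ j, ∃ i, PureCD.block P.A j i ≠ 0)
    -- global Lipschitz constant of the gradient of `f`
    (βbar : NNReal) (hβbar : LipschitzWith βbar (gradient P.f))
    -- random indices: independent, with `ℙ(i_{k+1} = i) = p_i`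
    {Ω : Type*} [MeasurableSpace Ω] (μ : Measure Ω) [IsProbabilityMeasure μ]
    (idx : ℕ → Ω → Fin n) (hmeas : ∀ k, Measurable (idx k)) (hindep : iIndepFun idx μ)
    (hlaw : ∀ k i, μ.real {ω | idx k ω = i} = a.p i)
    -- the iterates
    (x0 : PureCD.BlockSpace dX) (y0 : PureCD.BlockSpace dY) (hx0 : P.gSum x0 ≠ ⊤)
    (x xbar : ℕ → Ω → PureCD.BlockSpace dX) (y ybar : ℕ → Ω → PureCD.BlockSpace dY)
    (hrun : PureCD.IsPureCD P a idx x0 y0 x xbar y ybar)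
    -- metric subregularity at every solution, full iterates in the regularity neighbourhoods
    (η : PureCD.PDSpace dX dY → ℝ) (N : PureCD.PDSpace dX dY → Set (PureCD.PDSpace dX dY))
    (hsub : ∀ u ∈ P.solutions, PureCD.MetricallySubregularAt P.kkt u 0 (η u) (N u))
    (hN : ∀ᵐ ω ∂μ, ∀ k, ∀ u ∈ P.solutions,
      PureCD.pair (xbar (k + 1) ω) (ybar (k + 1) ω) ∈ N u) :
    -- the Bregman-type projections are well defined
    (∀ k ω, ∃! u, PureCD.IsBregmanProj P a (x k ω) (y k ω) u) ∧
    ∀ (z0s : PureCD.PDSpace dX dY) (zs : ℕ → Ω → PureCD.PDSpace dX dY),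
      PureCD.IsBregmanProj P a x0 y0 z0s →
      (∀ k ω, PureCD.IsBregmanProj P a (x k ω) (y k ω) (zs k ω)) →
      ∀ u ∈ P.solutions,
        0 < PureCD.rate P a βbar (η u) ∧ PureCD.rate P a βbar (η u) < 1 ∧
        ∀ k : ℕ,
          Integrable (fun ω => PureCD.V P a (PureCD.pair (x k ω) (y k ω) - zs k ω)) μ ∧
          ∫ ω, PureCD.V P a (PureCD.pair (x k ω) (y k ω) - zs k ω) ∂μ ≤
            (1 - PureCD.rate P a βbar (η u)) ^ k *
              (P.Dp x0 z0s + PureCD.V P a (PureCD.pair x0 y0 - z0s)) := by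
  have hex : ∀ k ω, ∃! u, PureCD.IsBregmanProj P a (x k ω) (y k ω) u := by
    intro k ω
    obtain ⟨u, hu⟩ := PureCD.exists_isBregmanProj hP ha hrow hβbar
      (hrun.gSum_ne_top hP ha hx0 k ω) (y k ω)
    exact ⟨u, hu, fun v hv => hv.unique hP ha hrow hβbar hu⟩
  refine ⟨hex, fun z0s zs hz0s hzs u hu => ?_⟩
  have hη := (hsub u hu).pos
  have hρ := ha.rate_lt_one (P := P) βbar.coe_nonneg hη
  refine ⟨ha.rate_pos hrow βbar.coe_nonneg hη, hρ, fun k => ?_⟩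
  have hNu : ∀ᵐ ω ∂μ, ∀ k, PureCD.pair (xbar (k + 1) ω) (ybar (k + 1) ω) ∈ N u := by
    filter_upwards [hN] with ω hω k using hω k u hu
  have hdep : ∀ k (F : PureCD.BlockSpace dX → PureCD.BlockSpace dY → PureCD.PDSpace dX dY → ℝ),
      Integrable (fun ω => F (x k ω) (y k ω) (zs k ω)) μ := fun k F =>
    (hrun.dependsOnPast_proj hP ha hrow hβbar hzs k F).integrable hmeas
  have hdecay : ∀ k, ∫ ω, (P.Dp (x k ω) (zs k ω)
      + PureCD.V P a (PureCD.pair (x k ω) (y k ω) - zs k ω)) ∂μ ≤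
      (1 - PureCD.rate P a βbar (η u)) ^ k *
        (P.Dp x0 z0s + PureCD.V P a (PureCD.pair x0 y0 - z0s)) := by
    intro k
    induction k with
    | zero =>
      have h0 : ∀ ω, zs 0 ω = z0s := fun ω => by
        have h := hzs 0 ω
        rw [hrun.init_x, hrun.init_y] at h
        exact h.unique hP ha hrow hβbar hz0s
      simp [hrun.init_x, hrun.init_y, h0]
    | succ k ih =>
      refine (hrun.integral_lyapunov_le hP ha hrow hβbar hmeas hindep hlaw hx0 (hsub u hu) hNu hzs
        k).trans ?_
      rw [pow_succ', mul_assoc]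
      exact mul_le_mul_of_nonneg_left ih (sub_nonneg.2 hρ.le)
  refine ⟨hdep k fun x y z => PureCD.V P a (PureCD.pair x y - z), le_trans ?_ (hdecay k)⟩
  refine integral_mono (hdep k fun x y z => PureCD.V P a (PureCD.pair x y - z))
    (hdep k fun x y z => P.Dp x z + PureCD.V P a (PureCD.pair x y - z)) fun ω => ?_
  exact le_add_of_nonneg_left (hP.Dp_nonneg (hrun.gSum_ne_top hP ha hx0 k ω) (hzs k ω).1)
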